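/- Let $\mathbb K$ be a field and $G$ a finite group. For a subgroup $H\le G$ put $\mu_{\mathbb K}(H)=H^2(H,\mathbb K^\times)$ with trivial action on $\mathbb K^\times$. A $\mu_{\mathbb K}$-decorated $G$-set is a $G$-set $X$ with a frill $\pi_x\in\mu_{\mathbb K}(G_x)$ for each $x\in X$ ($G_x$ the stabiliser), equivariant in the sense that $\pi_{gx}$ is the pull-back of $\pi_x$ along $G_{gx}\to G_x$, $a\mapsto g^{-1}ag$. Isomorphisms are $G$-equivariant bijections that preserve the frills. On isomorphism classes of finite decorated $G$-sets put $[X]+[Y]=[X\sqcup Y]$, $[X]\cdot[Y]=[X\times Y]$ with $\pi_{(x,y)}=\pi_x|_{G_x\cap G_y}\,\pi_y|_{G_x\cap G_y}$, and $[X]^\vee=[X^\vee]$, where $X^\vee$ is the $G$-set $X$ with the frills $\pi_x^{-1}$ (these are the operations of the Burnside ring $\mathbb B^\mu(G)$). A $G$-algebra is an associative unital $\mathbb K$-algebra $A$ with an action of $G$ by $\mathbb K$-algebra automorphisms. For an $A$-module $M$ and $g\in G$ let $M^{[g]}$ be $M$ with the new action $a\cdot m=g(a)m$; then $(M^{[g]})^{[h]}=M^{[gh]}$.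 Two $G$-algebras $A,B$ are $G$-Morita equivalent if there is a $\mathbb K$-linear equivalence of categories $\Phi:A\text{-Mod}\to B\text{-Mod}$ with natural isomorphisms $\beta_g(M):\Phi(M^{[g]})\to\Phi(M)^{[g]}$, $g\in G$, such that $\beta_{gh}(M)=\beta_g(M)^{[h]}\circ\beta_h(M^{[g]})$ for all $g,h\in G$ and all $M$. A simple $A$-module $M$ is absolutely simple if $\mathrm{End}_A(M)=\mathbb K$; $A$ is semisimple split if it is semisimple and each simple $A$-module is absolutely simple. For a $G$-algebra $A$ let $\mathrm{Irr}(A)$ be the set of isomorphism classes of absolutely simple $A$-modules, with the action $g\cdot[M]=[M^{[g^{-1}]}]$ and with the following frills. For $g\in G_{[M]}$ there is $T_g\in \mathrm{GL}(M)$, unique up to a scalar, with $T_g(am)=g(a)T_g(m)$ for all $a\in A$, $m\in M$; then $T_gT_h=\theta_M(g,h)T_{gh}$ for a cocycle $\theta_M\in Z^2(G_{[M]},\mathbb K^\times)$, and $\pi_{[M]}=[\theta_M]$. This makes $\mathrm{Irr}(A)$ a $\mu_{\mathbb K}$-decorated $G$-set. **Theorem.** $\mathrm{Irr}(A)$ is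 finite for each semisimple split $G$-algebra $A$, and $\Upsilon([A])=[\mathrm{Irr}(A)]$ is a well-defined bijection from the set of $G$-Morita equivalence classes of semisimple split $G$-algebras to the set of isomorphism classes of finite $\mu_{\mathbb K}$-decorated $G$-sets. Moreover, for all semisimple split $G$-algebras $A$ and $B$, the $G$-algebras $A\otimes_{\mathbb K} B$, $A\oplus B$ and $A^{op}$ (with $g(a\otimes b)=g(a)\otimes g(b)$, $g(a,b)=(g(a),g(b))$, and the action on $A^{op}$ that of $A$) are semisimple split, and $$\Upsilon([A\otimes B])=\Upsilon([A])\,\Upsilon([B]),\qquad \Upsilon([A\oplus B])=\Upsilon([A])+\Upsilon([B]),\qquad \Upsilon([A^{op}])=\Upsilon([A])^\vee .$$ -/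

import Mathlib

open CategoryTheory
open scoped TensorProduct ModuleCat

universe u v w

noncomputable section

namespace GMorita

/-! ### The functor `μ_K(H) = H²(H, Kˣ)` (trivial action) -/

/-- Normalisation-free `2`-cocycles of `H` with values in `Kˣ`, on which `H` acts trivially. -/
def Z2 (H : Type v) [Group H] (K : Type u) [Field K] : Subgroup (H × H → Kˣ) where
  carrier := {f | ∀ a b c, f (a * b, c) * f (a, b) = f (b, c) * f (a, b * c)}
  one_mem' := by intro a b c; simp
  mul_mem' := by
    intro f f' hf hf' a b c
    have h1 := hf a b c
    have h2 := hf' a b c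
    simp only [Pi.mul_apply]
    rw [mul_mul_mul_comm, h1, h2, mul_mul_mul_comm]
  inv_mem' := by
    intro f hf a b c
    have h1 := hf a b c
    simp only [Pi.inv_apply]
    rw [← mul_inv, h1, mul_inv]

/-- The coboundary map from `1`-cochains to `2`-cocycles. -/
def coboundary (H : Type v) [Group H] (K : Type u) [Field K] : (H → Kˣ) →* Z2 H K where
  toFun x := ⟨fun p => x p.1 * x p.2 * (x (p.1 * p.2))⁻¹, by
    intro a b c
    apply Units.ext
    simp only [Units.val_mul, Units.val_inv_eq_inv_val, mul_assoc a b c]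
    field_simp⟩
  map_one' := by ext p; simp
  map_mul' x y := by
    ext p
    simp only [Subgroup.coe_mul, Pi.mul_apply, Units.val_mul, Units.val_inv_eq_inv_val]
    field_simp

/-- `μ_K(H) = H²(H, Kˣ)`: cocycles modulo coboundaries, a (multiplicative) abelian group. -/
abbrev Mu (H : Type v) [Group H] (K : Type u) [Field K] : Type (max u v) :=
  Z2 H K ⧸ (coboundary H K).range

/-- Pull-back of cocycles along a group homomorphism. -/
def Z2.comap {H : Type v} {L : Type w} [Group H] [Group L] (K : Type u) [Field K] (f : H →* L) :
    Z2 L K →* Z2 H K where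
  toFun θ := ⟨fun p => θ.1 (f p.1, f p.2), by
    intro a b c
    have h := θ.2 (f a) (f b) (f c)
    simpa only [map_mul] using h⟩
  map_one' := by ext p; simp
  map_mul' x y := by ext p; simp

/-- The homomorphism `μ_K(L) → μ_K(H)` induced by a group homomorphism `H → L`. -/
def Mu.map {H : Type v} {L : Type w} [Group H] [Group L] (K : Type u) [Field K] (f : H →* L) :
    Mu L K →* Mu H K :=
  QuotientGroup.map _ _ (Z2.comap K f) (by
    rintro _ ⟨x, rfl⟩
    refine ⟨x ∘ f, ?_⟩
    ext p
    simp [Z2.comap, coboundary])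

lemma Mu.map_map {H : Type v} {L : Type w} {N : Type*} [Group H] [Group L] [Group N]
    (K : Type u) [Field K] (f : H →* L) (f' : L →* N) (c : Mu N K) :
    Mu.map K f (Mu.map K f' c) = Mu.map K (f'.comp f) c := by
  induction c using QuotientGroup.induction_on with
  | H z => rfl

/-- For subgroups `A`, `B` of `G` and `x ∈ G` with `x A x⁻¹ ⊆ B`, the morphism
`γ_x : A → B`, `a ↦ x a x⁻¹`, of the category of subgroups of `G`. -/
def conjHom {G : Type v} [Group G] (x : G) (A B : Subgroup G)
    (h : ∀ a ∈ A, x * a * x⁻¹ ∈ B) : A →* B where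
  toFun a := ⟨x * a * x⁻¹, h a a.2⟩
  map_one' := by ext; simp
  map_mul' a b := by ext; simp [mul_assoc]

/-- The contravariant functor `μ_K` on the category of subgroups of `G`:
`μ_K(γ_x : A → B) : μ_K(B) → μ_K(A)`. -/
def muConj {G : Type v} [Group G] (K : Type u) [Field K] (x : G) (A B : Subgroup G)
    (h : ∀ a ∈ A, x * a * x⁻¹ ∈ B) : Mu B K →* Mu A K :=
  Mu.map K (conjHom x A B h)

lemma muConj_comp {G : Type v} [Group G] (K : Type u) [Field K] (x y z : G) (A B C : Subgroup G)
    (h : ∀ a ∈ A, x * a * x⁻¹ ∈ B) (h' : ∀ a ∈ B, y * a * y⁻¹ ∈ C)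
    (h'' : ∀ a ∈ A, z * a * z⁻¹ ∈ C) (hz : z = y * x) (c : Mu C K) :
    muConj K x A B h (muConj K y B C h' c) = muConj K z A C h'' c := by
  subst hz
  rw [muConj, muConj, muConj, Mu.map_map]
  congr 2
  ext a
  simp [conjHom, mul_assoc]

/-! ### Decorated `G`-sets -/

section Decorated

variable {G : Type v} [Group G]

/-- The stabiliser of a point. -/
abbrev stab (G : Type v) [Group G] {X : Type w} [MulAction G X] (x : X) : Subgroup G :=
  MulAction.stabilizer G x

lemma conj_stab {X : Type w} [MulAction G X] (g : G) (x : X) :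
    ∀ a ∈ stab G (g • x), g⁻¹ * a * g⁻¹⁻¹ ∈ stab G x := by
  intro a ha
  rw [MulAction.mem_stabilizer_iff] at ha ⊢
  rw [inv_inv, mul_smul, mul_smul, ha, inv_smul_smul]

lemma stab_fst {X Y : Type w} [MulAction G X] [MulAction G Y] (p : X × Y) :
    stab G p ≤ stab G p.1 := by
  intro a ha
  rw [MulAction.mem_stabilizer_iff] at ha ⊢
  exact congrArg Prod.fst ha

lemma stab_snd {X Y : Type w} [MulAction G X] [MulAction G Y] (p : X × Y) :
    stab G p ≤ stab G p.2 := by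
  intro a ha
  rw [MulAction.mem_stabilizer_iff] at ha ⊢
  exact congrArg Prod.snd ha

lemma stab_map_le {X Y : Type w} [MulAction G X] [MulAction G Y] {f : X → Y}
    (hf : ∀ (g : G) (x : X), f (g • x) = g • f x) (x : X) : stab G x ≤ stab G (f x) := by
  intro a ha
  rw [MulAction.mem_stabilizer_iff] at ha ⊢
  rw [← hf, ha]

lemma conj_one {A B : Subgroup G} (h : A ≤ B) : ∀ a ∈ A, (1 : G) * a * 1⁻¹ ∈ B := by
  intro a ha
  simpa using h ha

end Decorated

/-- A (not necessarily finite) `μ_K`-decorated `G`-set: a `G`-set with a frill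
`π_x ∈ μ_K(G_x)` at each point, equivariant in the sense that `π_{gx}` is the transport of `π_x`
along `G_{gx} → G_x`, `a ↦ g⁻¹ a g`. -/
structure DecSet (K : Type u) [Field K] (G : Type v) [Group G] where
  carrier : Type w
  [action : MulAction G carrier]
  frill : ∀ x : carrier, Mu (stab G x) K
  equivariant : ∀ (g : G) (x : carrier),
    frill (g • x) = muConj K g⁻¹ (stab G (g • x)) (stab G x) (conj_stab g x) (frill x)

attribute [instance] DecSet.action

namespace DecSet

variable {K : Type u} [Field K] {G : Type v} [Group G]

/-- Isomorphism of decorated `G`-sets: an equivariant bijection that preserves the frills. Here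
`μ_K(γ_1)` identifies `μ_K(G_{f x})` with `μ_K(G_x)`, the two stabilisers being equal. -/
def Isomorphic (X Y : DecSet.{u, v, w} K G) : Prop :=
  ∃ (f : X.carrier ≃ Y.carrier) (hf : ∀ (g : G) (x : X.carrier), f (g • x) = g • f x),
    ∀ x : X.carrier,
      X.frill x = muConj K 1 (stab G x) (stab G (f x)) (conj_one (stab_map_le hf x))
        (Y.frill (f x))

/-- Equal subgroups of the group `G` give the same transport: used to change base points. -/
lemma frill_congr (X : DecSet.{u, v, w} K G) {x y : X.carrier} (hxy : x = y)
    (h : stab G x ≤ stab G y) :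
    X.frill x = muConj K 1 (stab G x) (stab G y) (conj_one h) (X.frill y) := by
  subst hxy
  generalize X.frill x = c
  induction c using QuotientGroup.induction_on with
  | H z =>
    change _ = QuotientGroup.mk _
    congr 1
    ext p
    simp only [conjHom, one_mul, inv_one, mul_one]
    rfl

lemma isomorphic_equivalence : Equivalence (Isomorphic (K := K) (G := G)) where
  refl X := ⟨Equiv.refl _, fun _ _ => rfl, fun x => X.frill_congr rfl le_rfl⟩
  symm := by
    rintro X Y ⟨f, hf, hfr⟩
    have hf' : ∀ (g : G) (y : Y.carrier), f.symm (g • y) = g • f.symm y := by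
      intro g y
      rw [Equiv.symm_apply_eq, hf, Equiv.apply_symm_apply]
    refine ⟨f.symm, hf', fun y => ?_⟩
    have h2 : stab G y ≤ stab G (f (f.symm y)) :=
      (stab_map_le hf' y).trans (stab_map_le hf _)
    rw [hfr (f.symm y), muConj_comp K 1 1 1 _ _ _ _ _ (conj_one h2) (by simp)]
    exact Y.frill_congr (by simp) h2
  trans := by
    rintro X Y Z ⟨f, hf, hfr⟩ ⟨f', hf', hfr'⟩
    refine ⟨f.trans f', fun g x => by simp [hf, hf'], fun x => ?_⟩
    rw [hfr x, hfr' (f x)]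
    exact muConj_comp K 1 1 1 _ _ _ _ _ _ (by simp) _

/-- The product of decorated `G`-sets: `X × Y` with the diagonal action and
`π_{(x,y)} = μ_K(γ_1)(π_x) μ_K(γ_1)(π_y)`, using `G_{(x,y)} = G_x ∩ G_y`. -/
def prod (X Y : DecSet.{u, v, w} K G) : DecSet.{u, v, w} K G where
  carrier := X.carrier × Y.carrier
  frill p :=
    muConj K 1 (stab G p) (stab G p.1) (conj_one (stab_fst p)) (X.frill p.1) *
    muConj K 1 (stab G p) (stab G p.2) (conj_one (stab_snd p)) (Y.frill p.2)
  equivariant := by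
    rintro g ⟨x, y⟩
    rw [map_mul]
    congr 1
    · change muConj K 1 (stab G (g • (x, y))) (stab G (g • x)) _ (X.frill (g • x)) =
        muConj K g⁻¹ _ _ _ (muConj K 1 _ _ _ (X.frill x))
      have h3 : ∀ a ∈ stab G (g • (x, y)), g⁻¹ * a * g⁻¹⁻¹ ∈ stab G x := fun a ha =>
        conj_stab g x a (stab_fst (g • (x, y)) ha)
      rw [X.equivariant g x, muConj_comp K 1 g⁻¹ g⁻¹ _ _ _ _ _ h3 (by simp)]
      exact (muConj_comp K g⁻¹ 1 g⁻¹ _ _ _ _ _ h3 (by simp) _).symm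
    · change muConj K 1 (stab G (g • (x, y))) (stab G (g • y)) _ (Y.frill (g • y)) =
        muConj K g⁻¹ _ _ _ (muConj K 1 _ _ _ (Y.frill y))
      have h3 : ∀ a ∈ stab G (g • (x, y)), g⁻¹ * a * g⁻¹⁻¹ ∈ stab G y := fun a ha =>
        conj_stab g y a (stab_snd (g • (x, y)) ha)
      rw [Y.equivariant g y, muConj_comp K 1 g⁻¹ g⁻¹ _ _ _ _ _ h3 (by simp)]
      exact (muConj_comp K g⁻¹ 1 g⁻¹ _ _ _ _ _ h3 (by simp) _).symm

lemma stab_inl {X Y : Type w} [MulAction G X] [MulAction G Y] (x : X) :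
    stab G (Sum.inl x : X ⊕ Y) ≤ stab G x := by
  intro a ha
  exact Sum.inl_injective (β := Y) ha

lemma stab_inr {X Y : Type w} [MulAction G X] [MulAction G Y] (y : Y) :
    stab G (Sum.inr y : X ⊕ Y) ≤ stab G y := by
  intro a ha
  exact Sum.inr_injective (α := X) ha

/-- The sum (disjoint union) of decorated `G`-sets. -/
def sum (X Y : DecSet.{u, v, w} K G) : DecSet.{u, v, w} K G where
  carrier := X.carrier ⊕ Y.carrier
  frill
    | Sum.inl x => muConj K 1 _ (stab G x) (conj_one (stab_inl x)) (X.frill x)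
    | Sum.inr y => muConj K 1 _ (stab G y) (conj_one (stab_inr y)) (Y.frill y)
  equivariant := by
    rintro g (x | y)
    · change muConj K 1 (stab G (Sum.inl (g • x) : X.carrier ⊕ Y.carrier)) (stab G (g • x)) _
        (X.frill (g • x)) = muConj K g⁻¹ _ _ _ (muConj K 1 _ _ _ (X.frill x))
      have h3 : ∀ a ∈ stab G (Sum.inl (g • x) : X.carrier ⊕ Y.carrier),
          g⁻¹ * a * g⁻¹⁻¹ ∈ stab G x := fun a ha => conj_stab g x a (stab_inl _ ha)
      rw [X.equivariant g x, muConj_comp K 1 g⁻¹ g⁻¹ _ _ _ _ _ h3 (by simp)]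
      exact (muConj_comp K g⁻¹ 1 g⁻¹ _ _ _ _ _ h3 (by simp) _).symm
    · change muConj K 1 (stab G (Sum.inr (g • y) : X.carrier ⊕ Y.carrier)) (stab G (g • y)) _
        (Y.frill (g • y)) = muConj K g⁻¹ _ _ _ (muConj K 1 _ _ _ (Y.frill y))
      have h3 : ∀ a ∈ stab G (Sum.inr (g • y) : X.carrier ⊕ Y.carrier),
          g⁻¹ * a * g⁻¹⁻¹ ∈ stab G y := fun a ha => conj_stab g y a (stab_inr _ ha)
      rw [Y.equivariant g y, muConj_comp K 1 g⁻¹ g⁻¹ _ _ _ _ _ h3 (by simp)]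
      exact (muConj_comp K g⁻¹ 1 g⁻¹ _ _ _ _ _ h3 (by simp) _).symm

/-- The dual decorated `G`-set: same `G`-set, inverted frills. -/
def dual (X : DecSet.{u, v, w} K G) : DecSet.{u, v, w} K G where
  carrier := X.carrier
  frill x := (X.frill x)⁻¹
  equivariant g x := by rw [X.equivariant, map_inv]

lemma prod_isomorphic {X X' Y Y' : DecSet.{u, v, w} K G} (hX : Isomorphic X X')
    (hY : Isomorphic Y Y') : Isomorphic (X.prod Y) (X'.prod Y') := by
  obtain ⟨f, hf, hfr⟩ := hX
  obtain ⟨f', hf', hfr'⟩ := hY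
  refine ⟨Equiv.prodCongr f f', fun g p => Prod.ext (hf g p.1) (hf' g p.2), ?_⟩
  rintro ⟨x, y⟩
  change muConj K 1 _ _ _ (X.frill x) * muConj K 1 _ _ _ (Y.frill y) =
    muConj K 1 _ _ _ (muConj K 1 _ _ _ (X'.frill (f x)) * muConj K 1 _ _ _ (Y'.frill (f' y)))
  rw [hfr x, hfr' y]
  refine Eq.trans ?_ (map_mul (muConj K 1 _ _ _) _ _).symm
  have e1 : stab G ((x, y) : X.carrier × Y.carrier) ≤ stab G (f x) := fun a ha =>
    stab_map_le hf x (stab_fst (x, y) ha)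
  have e2 : stab G ((x, y) : X.carrier × Y.carrier) ≤ stab G (f' y) := fun a ha =>
    stab_map_le hf' y (stab_snd (x, y) ha)
  congr 1
  · exact (muConj_comp K 1 1 1 _ _ _ _ _ (conj_one e1) (by simp) _).trans
      (muConj_comp K 1 1 1 _ _ _ _ _ (conj_one e1) (by simp) _).symm
  · exact (muConj_comp K 1 1 1 _ _ _ _ _ (conj_one e2) (by simp) _).trans
      (muConj_comp K 1 1 1 _ _ _ _ _ (conj_one e2) (by simp) _).symm

lemma sum_isomorphic {X X' Y Y' : DecSet.{u, v, w} K G} (hX : Isomorphic X X')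
    (hY : Isomorphic Y Y') : Isomorphic (X.sum Y) (X'.sum Y') := by
  obtain ⟨f, hf, hfr⟩ := hX
  obtain ⟨f', hf', hfr'⟩ := hY
  refine ⟨Equiv.sumCongr f f', ?_, ?_⟩
  · rintro g (x | y)
    · exact congrArg Sum.inl (hf g x)
    · exact congrArg Sum.inr (hf' g y)
  · rintro (x | y)
    · change muConj K 1 _ _ _ (X.frill x) = muConj K 1 _ _ _ (muConj K 1 _ _ _ (X'.frill (f x)))
      rw [hfr x]
      have e1 : stab G (Sum.inl x : X.carrier ⊕ Y.carrier) ≤ stab G (f x) := fun a ha =>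
        stab_map_le hf x (stab_inl _ ha)
      exact (muConj_comp K 1 1 1 _ _ _ _ _ (conj_one e1) (by simp) _).trans
        (muConj_comp K 1 1 1 _ _ _ _ _ (conj_one e1) (by simp) _).symm
    · change muConj K 1 _ _ _ (Y.frill y) = muConj K 1 _ _ _ (muConj K 1 _ _ _ (Y'.frill (f' y)))
      rw [hfr' y]
      have e1 : stab G (Sum.inr y : X.carrier ⊕ Y.carrier) ≤ stab G (f' y) := fun a ha =>
        stab_map_le hf' y (stab_inr _ ha)
      exact (muConj_comp K 1 1 1 _ _ _ _ _ (conj_one e1) (by simp) _).trans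
        (muConj_comp K 1 1 1 _ _ _ _ _ (conj_one e1) (by simp) _).symm

lemma dual_isomorphic {X X' : DecSet.{u, v, w} K G} (hX : Isomorphic X X') :
    Isomorphic X.dual X'.dual := by
  obtain ⟨f, hf, hfr⟩ := hX
  refine ⟨f, hf, fun x => ?_⟩
  change (X.frill x)⁻¹ = muConj K 1 _ _ _ (X'.frill (f x))⁻¹
  rw [hfr x, map_inv]

end DecSet

/-- Finite decorated `G`-sets. -/
def FinDecSet (K : Type u) [Field K] (G : Type v) [Group G] : Type (max u v (w + 1)) :=
  {X : DecSet.{u, v, w} K G // Finite X.carrier}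

/-- Isomorphism of finite decorated `G`-sets, as a setoid. -/
def finDecSetoid (K : Type u) [Field K] (G : Type v) [Group G] :
    Setoid (FinDecSet.{u, v, w} K G) where
  r X Y := DecSet.Isomorphic X.1 Y.1
  iseqv := ⟨fun X => DecSet.isomorphic_equivalence.refl X.1,
    DecSet.isomorphic_equivalence.symm, DecSet.isomorphic_equivalence.trans⟩

/-- The set of isomorphism classes of finite `μ_K`-decorated `G`-sets. Its sum, product and duality
are those of the Burnside ring `B^{μ_K}(G)`, which is its Grothendieck ring. -/
def DecClass (K : Type u) [Field K] (G : Type v) [Group G] : Type (max u v (w + 1)) :=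
  Quotient (finDecSetoid.{u, v, w} K G)

namespace DecClass

variable {K : Type u} [Field K] {G : Type v} [Group G]

/-- The isomorphism class `[X]` of a finite decorated `G`-set. -/
def mk (X : DecSet.{u, v, w} K G) (hX : Finite X.carrier) : DecClass.{u, v, w} K G :=
  Quotient.mk _ ⟨X, hX⟩

/-- `[X] + [Y] = [X ⊔ Y]`. -/
instance : Add (DecClass.{u, v, w} K G) where
  add := Quotient.map₂ (sa := finDecSetoid K G) (sb := finDecSetoid K G) (sc := finDecSetoid K G)
    (fun X Y => ⟨X.1.sum Y.1, by
      have := X.2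
      have := Y.2
      exact inferInstanceAs (Finite (X.1.carrier ⊕ Y.1.carrier))⟩)
    (fun _ _ h _ _ h' => DecSet.sum_isomorphic h h')

/-- `[X] [Y] = [X × Y]`. -/
instance : Mul (DecClass.{u, v, w} K G) where
  mul := Quotient.map₂ (sa := finDecSetoid K G) (sb := finDecSetoid K G) (sc := finDecSetoid K G)
    (fun X Y => ⟨X.1.prod Y.1, by
      have := X.2
      have := Y.2
      exact inferInstanceAs (Finite (X.1.carrier × Y.1.carrier))⟩)
    (fun _ _ h _ _ h' => DecSet.prod_isomorphic h h')

/-- `[X]^∨ = [X^∨]`. -/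
def dual : DecClass.{u, v, w} K G → DecClass.{u, v, w} K G :=
  Quotient.map (sa := finDecSetoid K G) (sb := finDecSetoid K G)
    (fun X => ⟨X.1.dual, X.2⟩) (fun _ _ h => DecSet.dual_isomorphic h)

end DecClass

/-! ### `G`-algebras -/

/-- A `G`-algebra over `K`: an associative unital `K`-algebra on which `G` acts by `K`-algebra
automorphisms. -/
structure GAlgebra (K : Type u) [Field K] (G : Type v) [Group G] where
  carrier : Type u
  [ring : Ring carrier]
  [algebra : Algebra K carrier]
  [action : MulSemiringAction G carrier]
  [comm : SMulCommClass G K carrier]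

attribute [instance] GAlgebra.ring GAlgebra.algebra GAlgebra.action GAlgebra.comm

namespace GAlgebra

variable {K : Type u} [Field K] {G : Type v} [Group G]

/-- `A ⊗ B` with `g (a ⊗ b) = g a ⊗ g b`. -/
def tensor (A B : GAlgebra K G) : GAlgebra K G :=
  letI act : MulSemiringAction G (A.carrier ⊗[K] B.carrier) :=
    { smul := fun g => Algebra.TensorProduct.map (MulSemiringAction.toAlgHom K A.carrier g)
        (MulSemiringAction.toAlgHom K B.carrier g)
      one_smul := fun x => by
        change Algebra.TensorProduct.map _ _ x = x
        induction x with
        | zero => simp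
        | tmul a b => simp
        | add x y hx hy => rw [map_add, hx, hy]
      mul_smul := fun g h x => by
        change Algebra.TensorProduct.map _ _ x =
          Algebra.TensorProduct.map _ _ (Algebra.TensorProduct.map _ _ x)
        induction x with
        | zero => simp
        | tmul a b => simp [mul_smul]
        | add x y hx hy => simp only [map_add, hx, hy]
      smul_zero := fun g => map_zero (Algebra.TensorProduct.map _ _)
      smul_add := fun g => map_add (Algebra.TensorProduct.map _ _)
      smul_one := fun g => map_one (Algebra.TensorProduct.map _ _)
      smul_mul := fun g => map_mul (Algebra.TensorProduct.map _ _) }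
  { carrier := A.carrier ⊗[K] B.carrier
    action := act
    comm := @SMulCommClass.mk G K (A.carrier ⊗[K] B.carrier) act.toSMul _ fun g c x =>
      map_smul (Algebra.TensorProduct.map (MulSemiringAction.toAlgHom K A.carrier g)
        (MulSemiringAction.toAlgHom K B.carrier g)) c x }

/-- `A ⊕ B` with componentwise operations and `g (a, b) = (g a, g b)`. -/
def directSum (A B : GAlgebra K G) : GAlgebra K G :=
  letI act : MulSemiringAction G (A.carrier × B.carrier) :=
    { (inferInstance : DistribMulAction G (A.carrier × B.carrier)) with
      smul_one := fun g => Prod.ext (smul_one g) (smul_one g)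
      smul_mul := fun g x y => Prod.ext (smul_mul' g x.1 y.1) (smul_mul' g x.2 y.2) }
  { carrier := A.carrier × B.carrier
    action := act
    comm := ⟨fun g c x => Prod.ext (smul_comm g c x.1) (smul_comm g c x.2)⟩ }

/-- The opposite algebra, with the same action of `G`. -/
def opposite (A : GAlgebra K G) : GAlgebra K G :=
  letI act : MulSemiringAction G A.carrierᵐᵒᵖ :=
    { (inferInstance : DistribMulAction G A.carrierᵐᵒᵖ) with
      smul_one := fun g => congrArg MulOpposite.op (smul_one g)
      smul_mul := fun g x y => congrArg MulOpposite.op (smul_mul' g y.unop x.unop) }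
  { carrier := A.carrierᵐᵒᵖ
    action := act
    comm := ⟨fun g c x => congrArg MulOpposite.op (smul_comm g c x.unop)⟩ }

variable (A B : GAlgebra K G)

/-- The (right) action of `G` on `A-Mod`: the twist `M ↦ M^[g]`, which is `M` with the new action
`a · m = g(a) m`, and is the identity on morphisms. -/
def twist (g : G) : ModuleCat.{u} A.carrier ⥤ ModuleCat.{u} A.carrier :=
  ModuleCat.restrictScalars (MulSemiringAction.toRingHom G A.carrier g)

/-- The natural isomorphism `M^[gh] ≅ (M^[g])^[h]`, the identity on underlying groups. -/
def twistMul (g h : G) : A.twist (g * h) ≅ A.twist g ⋙ A.twist h :=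
  ModuleCat.restrictScalarsComp' (MulSemiringAction.toRingHom G A.carrier h)
    (MulSemiringAction.toRingHom G A.carrier g)
    (MulSemiringAction.toRingHom G A.carrier (g * h))
    (by ext a; simp [mul_smul])

/-- A `G`-equivalence `A-Mod → B-Mod`: a `K`-linear equivalence of categories `Φ` with natural
isomorphisms `β_g : Φ(X^[g]) ≅ Φ(X)^[g]` satisfying the pentagon axiom (of which two corners are
the identity isomorphisms `twistMul`). -/
structure GEquivalence where
  Φ : ModuleCat.{u} A.carrier ⥤ ModuleCat.{u} B.carrier
  isEquivalence : Φ.IsEquivalence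
  additive : Φ.Additive
  linear : Φ.Linear K
  β : ∀ g : G, A.twist g ⋙ Φ ≅ Φ ⋙ B.twist g
  pentagon : ∀ (g h : G) (X : ModuleCat.{u} A.carrier),
    Φ.map ((A.twistMul g h).hom.app X) ≫ (β h).hom.app ((A.twist g).obj X) ≫
      (B.twist h).map ((β g).hom.app X) =
    (β (g * h)).hom.app X ≫ (B.twistMul g h).hom.app (Φ.obj X)

/-- `G`-Morita equivalence of `G`-algebras. -/
def GMoritaEquivalent : Prop := Nonempty (GEquivalence A B)

/-- `M` is an absolutely simple `A`-module: it is simple and `End_A(M) = K`. -/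
structure IsAbsSimple (M : ModuleCat.{u} A.carrier) : Prop where
  simple : IsSimpleModule A.carrier M
  endo : ∀ f : M →ₗ[A.carrier] M, ∃ c : K, ∀ m, f m = algebraMap K A.carrier c • m

/-- `A` is semisimple and split: every simple `A`-module is absolutely simple. -/
structure IsSemisimpleSplit : Prop where
  semisimple : IsSemisimpleRing A.carrier
  split : ∀ M : ModuleCat.{u} A.carrier, IsSimpleModule A.carrier M → A.IsAbsSimple M

/-! ### The decorated set `Irr(A)` -/

/-- Absolutely simple `A`-modules. -/
def AbsSimple : Type (u + 1) := {M : ModuleCat.{u} A.carrier // A.IsAbsSimple M}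

/-- Isomorphism of absolutely simple modules, as a setoid. -/
def absSimpleSetoid : Setoid A.AbsSimple where
  r M N := Nonempty (M.1 ≃ₗ[A.carrier] N.1)
  iseqv := ⟨fun _ => ⟨LinearEquiv.refl _ _⟩, fun ⟨e⟩ => ⟨e.symm⟩, fun ⟨e⟩ ⟨f⟩ => ⟨e.trans f⟩⟩

/-- The set underlying `Irr(A)`: isomorphism classes of absolutely simple `A`-modules. -/
def IrrSet : Type (u + 1) := Quotient A.absSimpleSetoid

variable {A}

lemma smul_algebraMap' (g : G) (c : K) :
    g • algebraMap K A.carrier c = algebraMap K A.carrier c := by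
  rw [Algebra.algebraMap_eq_smul_one, smul_comm, smul_one]

lemma twist_smul (g : G) (M : ModuleCat.{u} A.carrier) (a : A.carrier) (m : M) :
    (show (A.twist g).obj M from a • (show (A.twist g).obj M from m)) = ((g • a) • m : M) := rfl

/-- A map that is semilinear for the twist, as a linear equivalence of twisted modules. -/
def linearEquivTwist {M N : ModuleCat.{u} A.carrier} (g h : G) (T : M ≃+ N)
    (hT : ∀ (a : A.carrier) (m : M), T ((g • a) • m) = (h • a) • T m) :
    (A.twist g).obj M ≃ₗ[A.carrier] (A.twist h).obj N :=
  { toFun := fun m => T m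
    map_add' := fun x y => T.map_add x y
    map_smul' := fun a m => hT a m
    invFun := fun m => T.symm m
    left_inv := fun m => T.symm_apply_apply m
    right_inv := fun m => T.apply_symm_apply m }

lemma IsAbsSimple.twist {M : ModuleCat.{u} A.carrier} (hM : A.IsAbsSimple M) (g : G) :
    A.IsAbsSimple ((A.twist g).obj M) := by
  have hs := hM.simple
  have key : ∀ (a : A.carrier) (m : M), (show M from (show (A.twist g).obj M from (g⁻¹ • a) •
      (show (A.twist g).obj M from m))) = a • m := fun a m => by
    rw [twist_smul, smul_inv_smul]
  refine ⟨?_, fun f => ?_⟩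
  · rw [isSimpleModule_iff_toSpanSingleton_surjective]
    refine ⟨IsSimpleModule.nontrivial A.carrier M, ?_⟩
    intro m hm y
    obtain ⟨a, ha⟩ := (isSimpleModule_iff_toSpanSingleton_surjective.mp hs).2
      (show M from m) hm (show M from y)
    exact ⟨g⁻¹ • a, (key a m).trans ha⟩
  · let f' : M →ₗ[A.carrier] M :=
      { toFun := fun m => f m
        map_add' := fun x y => f.map_add x y
        map_smul' := fun a m => by
          have h := f.map_smul (g⁻¹ • a) m
          exact (congrArg (fun z => f z) (key a m)).symm.trans (h.trans (key a (f m))) }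
    obtain ⟨c, hc⟩ := hM.endo f'
    refine ⟨c, fun m => (hc m).trans ?_⟩
    refine Eq.trans ?_ (twist_smul g M _ m).symm
    rw [smul_algebraMap']

/-- The action `g · [M] = [M^[g⁻¹]]` on `Irr(A)`. -/
instance irrAction : MulAction G A.IrrSet where
  smul g := Quotient.map (sa := A.absSimpleSetoid) (sb := A.absSimpleSetoid)
    (fun M => ⟨(A.twist g⁻¹).obj M.1, M.2.twist g⁻¹⟩)
    (fun _ _ ⟨e⟩ => ⟨linearEquivTwist g⁻¹ g⁻¹ e.toAddEquiv (fun a m => e.map_smul _ m)⟩)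
  one_smul x := by
    induction x using Quotient.inductionOn with
    | h M =>
      refine Quotient.sound (s := A.absSimpleSetoid) ⟨?_⟩
      exact
        { toFun := fun m => m
          map_add' := fun x y => rfl
          map_smul' := fun a m => by
            change ((1 : G)⁻¹ • a) • (show M.1 from m) = a • (show M.1 from m)
            rw [inv_one, one_smul]
          invFun := fun m => m
          left_inv := fun m => rfl
          right_inv := fun m => rfl }
  mul_smul g h x := by
    induction x using Quotient.inductionOn with
    | h M =>
      refine Quotient.sound (s := A.absSimpleSetoid) ⟨?_⟩
      exact
        { toFun := fun m => m
          map_add' := fun x y => rfl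
          map_smul' := fun a m => by
            change ((g * h)⁻¹ • a) • (show M.1 from m) = (h⁻¹ • (g⁻¹ • a)) • (show M.1 from m)
            rw [mul_inv_rev, mul_smul]
          invFun := fun m => m
          left_inv := fun m => rfl
          right_inv := fun m => rfl }

/-- The class `[M] ∈ Irr(A)`. -/
def irrMk (M : ModuleCat.{u} A.carrier) (hM : A.IsAbsSimple M) : A.IrrSet :=
  Quotient.mk _ ⟨M, hM⟩

/-- `θ` is an obstruction cocycle on `H ≤ G` of the `A`-module `M`: there are lifts `T h ∈ GL(M)`
of the projective transformations determined by `T h ∘ a ∘ (T h)⁻¹ = h(a)` for `a ∈ A`, and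
`T g ∘ T h = θ(g, h) T (gh)`. (Since `h` fixes the scalars, each `T h` is `K`-linear.) -/
def IsObstruction (M : ModuleCat.{u} A.carrier) (H : Subgroup G) (θ : Z2 H K) : Prop :=
  ∃ T : H → (M ≃+ M),
    (∀ (h : H) (a : A.carrier) (m : M), T h (a • m) = ((h : G) • a) • T h m) ∧
    ∀ (g h : H) (m : M),
      T g (T h m) = algebraMap K A.carrier (θ.1 (g, h) : K) • T (g * h) m

lemma IsAbsSimple.scalar_inj {M : ModuleCat.{u} A.carrier} (hM : A.IsAbsSimple M) {c d : K}
    (h : ∀ m : M, algebraMap K A.carrier c • m = algebraMap K A.carrier d • m) : c = d := by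
  have := hM.simple
  have := IsSimpleModule.nontrivial A.carrier M
  obtain ⟨m, hm⟩ := exists_ne (0 : M)
  by_contra hcd
  have h1 : algebraMap K A.carrier (c - d) • m = 0 := by
    rw [map_sub, sub_smul, h m, sub_self]
  apply hm
  have h2 : algebraMap K A.carrier ((c - d)⁻¹ * (c - d)) • m = 0 := by
    rw [map_mul, mul_smul, h1, smul_zero]
  rwa [inv_mul_cancel₀ (sub_ne_zero.mpr hcd), map_one, one_smul] at h2

/-- Two bijections of an absolutely simple module with the same semilinearity differ by a nonzero
scalar. -/
lemma IsAbsSimple.exists_unit {M : ModuleCat.{u} A.carrier} (hM : A.IsAbsSimple M) (g : G)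
    (S T : M ≃+ M) (hS : ∀ (a : A.carrier) (m : M), S (a • m) = (g • a) • S m)
    (hT : ∀ (a : A.carrier) (m : M), T (a • m) = (g • a) • T m) :
    ∃ c : Kˣ, ∀ m, S m = algebraMap K A.carrier (c : K) • T m := by
  have hT' : ∀ (a : A.carrier) (m : M), T.symm (a • m) = (g⁻¹ • a) • T.symm m := by
    intro a m
    apply T.injective
    rw [hT, T.apply_symm_apply, T.apply_symm_apply, smul_inv_smul]
  let f : M →ₗ[A.carrier] M :=
    { toFun := fun m => S (T.symm m)
      map_add' := fun x y => by simp
      map_smul' := fun a m => by simp [hT', hS] }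
  obtain ⟨c, hc⟩ := hM.endo f
  have := hM.simple
  have := IsSimpleModule.nontrivial A.carrier M
  have hc0 : c ≠ 0 := by
    rintro rfl
    obtain ⟨m, hm⟩ := exists_ne (0 : M)
    have h1 := hc (T (S.symm m))
    simp only [f, LinearMap.coe_mk, AddHom.coe_mk, T.symm_apply_apply, S.apply_symm_apply,
      map_zero, zero_smul] at h1
    exact hm h1
  refine ⟨Units.mk0 c hc0, fun m => ?_⟩
  have h1 := hc (T m)
  simpa [f] using h1

lemma exists_isObstruction {M : ModuleCat.{u} A.carrier} (hM : A.IsAbsSimple M) (H : Subgroup G)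
    (hH : ∀ h : H, ∃ T : M ≃+ M, ∀ (a : A.carrier) (m : M), T (a • m) = ((h : G) • a) • T m) :
    ∃ θ : Z2 H K, IsObstruction M H θ := by
  choose T hT using hH
  have h1 : ∀ p : H × H, ∃ c : Kˣ, ∀ m,
      ((T p.2).trans (T p.1)) m = algebraMap K A.carrier (c : K) • T (p.1 * p.2) m := by
    intro p
    refine hM.exists_unit ((p.1 * p.2 : H) : G) _ _ (fun a m => ?_) (hT _)
    simp [hT, mul_smul]
  choose θ hθ using h1
  have hθ' : ∀ (g h : H) (m : M),
      T g (T h m) = algebraMap K A.carrier (θ (g, h) : K) • T (g * h) m :=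
    fun g h m => hθ (g, h) m
  refine ⟨⟨θ, fun a b c => ?_⟩, T, hT, hθ'⟩
  apply Units.ext
  refine hM.scalar_inj fun m => ?_
  obtain ⟨m, rfl⟩ := (T (a * b * c)).surjective m
  have e1 : T a (T b (T c m)) =
      algebraMap K A.carrier ((θ (a * b, c) * θ (a, b) : Kˣ) : K) • T (a * b * c) m := by
    rw [hθ' a b, hθ' (a * b) c, ← mul_smul, ← map_mul, Units.val_mul, mul_comm]
  have e2 : T a (T b (T c m)) =
      algebraMap K A.carrier ((θ (b, c) * θ (a, b * c) : Kˣ) : K) • T (a * b * c) m := by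
    rw [hθ' b c, hT, smul_algebraMap', hθ' a (b * c), ← mul_smul, ← map_mul, Units.val_mul,
      mul_assoc a b c]
  rw [← e1, e2]

lemma isObstruction_unique {M : ModuleCat.{u} A.carrier} (hM : A.IsAbsSimple M) {H : Subgroup G}
    {θ θ' : Z2 H K} (h : IsObstruction M H θ) (h' : IsObstruction M H θ') :
    (QuotientGroup.mk θ : Mu H K) = QuotientGroup.mk θ' := by
  obtain ⟨T, hT, hθ⟩ := h
  obtain ⟨T', hT', hθ'⟩ := h'
  have h1 : ∀ k : H, ∃ c : Kˣ, ∀ m, T' k m = algebraMap K A.carrier (c : K) • T k m :=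
    fun k => hM.exists_unit k _ _ (hT' k) (hT k)
  choose x hx using h1
  rw [QuotientGroup.eq]
  refine ⟨x, ?_⟩
  rw [eq_inv_mul_iff_mul_eq]
  apply Subtype.ext
  funext ⟨g, k⟩
  change θ.1 (g, k) * (x g * x k * (x (g * k))⁻¹) = θ'.1 (g, k)
  rw [← mul_assoc, mul_inv_eq_iff_eq_mul]
  apply Units.ext
  refine hM.scalar_inj fun m => ?_
  obtain ⟨m, rfl⟩ := (T (g * k)).surjective m
  have e1 : T' g (T' k m) = algebraMap K A.carrier ((θ.1 (g, k) * (x g * x k) : Kˣ) : K) •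
      T (g * k) m := by
    rw [hx k, hT', smul_algebraMap', hx g, hθ, ← mul_smul, ← mul_smul, ← map_mul, ← map_mul]
    congr 2
    push_cast
    ring
  have e2 : T' g (T' k m) = algebraMap K A.carrier ((θ'.1 (g, k) * x (g * k) : Kˣ) : K) •
      T (g * k) m := by
    rw [hθ', hx, ← mul_smul, ← map_mul]
    push_cast
    rfl
  rw [← e1, e2]

/-- Transport of obstruction cocycles: if `S : M → N` satisfies `S (a m) = g(a) S m`, that is,
`N ≅ M^[g⁻¹]`, then a cocycle for `M` gives one for `N` by pull-back along `γ_{g⁻¹}`. -/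
lemma IsObstruction.transport {M N : ModuleCat.{u} A.carrier} (g : G) (S : M ≃+ N)
    (hS : ∀ (a : A.carrier) (m : M), S (a • m) = (g • a) • S m) {H L : Subgroup G}
    (hL : ∀ a ∈ L, g⁻¹ * a * g⁻¹⁻¹ ∈ H) {θ : Z2 H K} (h : IsObstruction M H θ) :
    IsObstruction N L (Z2.comap K (conjHom g⁻¹ L H hL) θ) := by
  obtain ⟨T, hT, hθ⟩ := h
  have hS' : ∀ (a : A.carrier) (n : N), S.symm (a • n) = (g⁻¹ • a) • S.symm n := by
    intro a n
    apply S.injective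
    rw [hS, S.apply_symm_apply, S.apply_symm_apply, smul_inv_smul]
  refine ⟨fun l => (S.symm.trans (T (conjHom g⁻¹ L H hL l))).trans S, fun l a n => ?_,
    fun l k n => ?_⟩
  · simp only [AddEquiv.trans_apply, hS', hT, hS]
    rw [← mul_smul, ← mul_smul]
    congr 2
    simp [conjHom, mul_assoc]
  · simp only [AddEquiv.trans_apply, S.symm_apply_apply, hθ, hS, smul_algebraMap', map_mul]
    rfl

lemma exists_semilinear_of_mem_stab (M : A.AbsSimple) (x : A.IrrSet)
    (hx : Quotient.mk _ M = x) (h : stab G x) :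
    ∃ T : M.1 ≃+ M.1, ∀ (a : A.carrier) (m : M.1), T (a • m) = ((h : G) • a) • T m := by
  subst hx
  have h1 : (Quotient.mk A.absSimpleSetoid
      ⟨(A.twist (h : G)⁻¹).obj M.1, M.2.twist (h : G)⁻¹⟩ : A.IrrSet) = Quotient.mk _ M := h.2
  obtain ⟨e⟩ := Quotient.exact (s := A.absSimpleSetoid) h1
  have he : ∀ (a : A.carrier) (m : M.1), e (((h : G)⁻¹ • a) • m : M.1) = a • e m :=
    fun a m => e.map_smul a m
  refine ⟨e.toAddEquiv, fun a m => ?_⟩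
  have h2 := he ((h : G) • a) m
  rw [inv_smul_smul] at h2
  exact h2

lemma exists_isObstruction_rep (x : A.IrrSet) :
    ∃ θ : Z2 (stab G x) K, IsObstruction (Quotient.out x).1 (stab G x) θ :=
  exists_isObstruction (Quotient.out x).2 _
    (exists_semilinear_of_mem_stab _ x (Quotient.out_eq x))

/-- The frill of `Irr(A)` at a point `x = [M]`: the class in `μ_K(G_x)` of an obstruction cocycle of
`M`; independent of all choices by `irrFrill_eq`. -/
def irrFrill (x : A.IrrSet) : Mu (stab G x) K :=
  QuotientGroup.mk (Classical.choose (exists_isObstruction_rep x))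

lemma irrFrill_eq (x : A.IrrSet) (M : A.AbsSimple) (hM : Quotient.mk _ M = x)
    (θ : Z2 (stab G x) K) (hθ : IsObstruction M.1 (stab G x) θ) :
    irrFrill x = QuotientGroup.mk θ := by
  obtain ⟨e⟩ := Quotient.exact (s := A.absSimpleSetoid) (hM.trans (Quotient.out_eq x).symm)
  have h0 : ∀ a ∈ stab G x, (1 : G)⁻¹ * a * (1 : G)⁻¹⁻¹ ∈ stab G x := fun a ha => by simpa using ha
  have h1 := IsObstruction.transport (1 : G) e.toAddEquiv
    (fun a m => by rw [one_smul]; exact e.map_smul a m) h0 hθ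
  have h2 : Z2.comap K (conjHom (1 : G)⁻¹ (stab G x) (stab G x) h0) θ = θ := by
    ext p
    simp [Z2.comap, conjHom]
  rw [h2] at h1
  exact isObstruction_unique (Quotient.out x).2
    (Classical.choose_spec (exists_isObstruction_rep x)) h1

variable (A) in
/-- The canonical `μ_K`-decorated `G`-set `Irr(A)`. -/
def Irr : DecSet.{u, v, u + 1} K G where
  carrier := A.IrrSet
  frill := irrFrill
  equivariant g x := by
    obtain ⟨M, rfl⟩ := Quotient.exists_rep x
    obtain ⟨θ, hθ⟩ := exists_isObstruction M.2 _ (exists_semilinear_of_mem_stab M _ rfl)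
    rw [irrFrill_eq _ M rfl θ hθ]
    refine irrFrill_eq _ ⟨(A.twist g⁻¹).obj M.1, M.2.twist g⁻¹⟩ rfl _ ?_
    refine IsObstruction.transport (N := (A.twist g⁻¹).obj M.1) g (AddEquiv.refl M.1) (fun a m => ?_) (conj_stab g _) hθ
    change a • (show M.1 from m) = (g⁻¹ • (g • a)) • (show M.1 from m)
    rw [inv_smul_smul]

end GAlgebra

/-- Semisimple split `G`-algebras over `K`. -/
def SplitGAlgebra (K : Type u) [Field K] (G : Type v) [Group G] : Type (max (u + 1) v) :=
  {A : GAlgebra K G // A.IsSemisimpleSplit}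

/-- `G`-Morita equivalence on semisimple split `G`-algebras. -/
def SplitGAlgebra.Rel (K : Type u) [Field K] (G : Type v) [Group G]
    (A B : SplitGAlgebra K G) : Prop :=
  GAlgebra.GMoritaEquivalent A.1 B.1

end GMorita

end

/-! A split semisimple algebra is `∏ End_K(V_i)`, with `V_i` running over its simple modules. An
action of `G` on it permutes the factors and acts between them as conjugation by linear maps that
are determined up to scalars. It therefore amounts to a projective action of `G` on `∏ V_i` lying
over the `G`-set `X = Irr(A)`, with a defect that is a 2-cocycle of `G` in the `G`-module of
functions `X → Kˣ`. By Shapiro's lemma such a cocycle is known, up to coboundary, from its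
restrictions to the stabilisers, and these are the frills: `IsTwistedCocycle.exists_cochain` gives
injectivity of restriction, `DecSet.exists_twistedCocycle` surjectivity onto equivariant families.

Invariance: a `g`-semilinear map is an isomorphism `M ≅ N^[g]`. A `G`-equivalence carries it to
another through `Φ` and `β_g`, and the pentagon axiom keeps the same cocycle (`mapSemilinear_mul`).
Surjectivity: a twisted cocycle acts projectively on its twisted regular representation, and
conjugation makes `∏ End` a `G`-algebra with the prescribed `Irr`. Injectivity: if `Irr(A) ≅
Irr(B)`, the two projective actions can be rescaled to have the same cocycle. The cocycles then
cancel on `Q = Hom_{K^X}(∏ W_i, ∏ V_i)`, which becomes an equivariant invertible bimodule, and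
`Hom_A(Q, -)` is a `G`-equivalence. Operations: duals, tensor products and disjoint unions of the
simple modules form complete families, and the corresponding lifts have cocycles `θ⁻¹`, `θη` and
`θ`.

The notion `IsComplete` records the Wedderburn isomorphism without choosing matrices, and
`GAlgebra.isomorphic_irr` reads off `Irr` from any complete family with its semilinear maps. -/

namespace GMorita

/-! ### Complete families of modules over a split semisimple algebra -/

/-- A family of finite-dimensional nonzero `A`-modules `V i` is complete if the action map
`A → ∏ i, End_K (V i)` is bijective. -/
structure IsComplete (K : Type*) (A : Type*) [Field K] [Ring A] [Algebra K A] {ι : Type*}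
    (V : ι → Type*) [∀ i, AddCommGroup (V i)] [∀ i, Module K (V i)] [∀ i, Module A (V i)] :
    Prop where
  finite : ∀ i, Module.Finite K (V i)
  nontrivial : ∀ i, Nontrivial (V i)
  injective : ∀ a : A, (∀ i, ∀ v : V i, a • v = 0) → a = 0
  surjective : ∀ φ : ∀ i, V i →ₗ[K] V i, ∃ a : A, ∀ i, ∀ v : V i, a • v = φ i v

namespace IsComplete

variable {K : Type*} {A : Type*} [Field K] [Ring A] [Algebra K A] {ι : Type*}
  {V : ι → Type*} [∀ i, AddCommGroup (V i)] [∀ i, Module K (V i)] [∀ i, Module A (V i)]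

lemma exists_single (h : IsComplete K A V) (i : ι) (φ : V i →ₗ[K] V i) :
    ∃ a : A, (∀ v : V i, a • v = φ v) ∧ ∀ j, j ≠ i → ∀ v : V j, a • v = 0 := by
  classical
  obtain ⟨a, ha⟩ := h.surjective (Pi.single i φ)
  refine ⟨a, fun v => by simpa using ha i v, fun j hj v => ?_⟩
  rw [ha j v, Pi.single_eq_of_ne hj, LinearMap.zero_apply]

lemma ext (h : IsComplete K A V) {a b : A} (hab : ∀ i, ∀ v : V i, a • v = b • v) : a = b :=
  sub_eq_zero.mp (h.injective _ fun i v => by rw [sub_smul, hab, sub_self])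

lemma exists_map_eq (i : ι) {v : V i} (hv : v ≠ 0) (w : V i) :
    ∃ φ : V i →ₗ[K] V i, φ v = w := by
  obtain ⟨f, hf⟩ : ∃ f : Module.Dual K (V i), f v ≠ 0 := by
    by_contra! hf
    exact hv ((Module.forall_dual_apply_eq_zero_iff K v).mp hf)
  exact ⟨f.smulRight ((f v)⁻¹ • w), by simp [smul_smul, hf]⟩

lemma simple (h : IsComplete K A V) (i : ι) : IsSimpleModule A (V i) := by
  rw [isSimpleModule_iff_toSpanSingleton_surjective]
  refine ⟨h.nontrivial i, fun v hv w => ?_⟩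
  obtain ⟨φ, hφ⟩ := exists_map_eq (K := K) i hv w
  obtain ⟨a, ha, -⟩ := h.exists_single i φ
  exact ⟨a, by simp [ha, hφ]⟩

/-- `A` acts on `V i` through all of `End_K(V i)`, so an `A`-endomorphism is central there, hence a
scalar. -/
lemma endo [∀ i, IsScalarTower K A (V i)] (h : IsComplete K A V) (i : ι) (f : V i →ₗ[A] V i) :
    ∃ c : K, ∀ v, f v = c • v := by
  have h1 : f.restrictScalars K ∈ Subalgebra.center K (Module.End K (V i)) := by
    rw [Subalgebra.mem_center_iff]
    intro φ
    obtain ⟨a, ha, -⟩ := h.exists_single i φ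
    ext v
    simp [← ha]
  rw [Algebra.IsCentral.center_eq_bot] at h1
  obtain ⟨c, hc⟩ := Algebra.mem_bot.mp h1
  exact ⟨c, fun v => (LinearMap.congr_fun hc v).symm⟩

/-- The central idempotent of the factor `i` is the identity on `V i` and kills every other member.
-/
lemma eq_of_linearEquiv (h : IsComplete K A V) {i j : ι} (e : V i ≃ₗ[A] V j) : i = j := by
  by_contra hij
  obtain ⟨a, ha, ha'⟩ := h.exists_single i LinearMap.id
  have := h.nontrivial i
  obtain ⟨v, hv⟩ := exists_ne (0 : V i)
  apply hv
  apply e.injective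
  rw [map_zero, ← ha' j (Ne.symm hij) (e v), ← e.map_smul, ha, LinearMap.id_apply]

/-- The action map of a complete family. -/
noncomputable def equiv [∀ i, IsScalarTower K A (V i)] (h : IsComplete K A V) :
    A ≃+* ∀ i, Module.End K (V i) :=
  RingEquiv.ofBijective (RingHom.pi fun i => (Algebra.lsmul K K (V i) : A →ₐ[K] Module.End K (V i)).toRingHom)
    ⟨(injective_iff_map_eq_zero _).mpr fun a ha => h.injective a fun i v =>
      LinearMap.congr_fun (congrFun ha i) v, fun φ => by
      obtain ⟨a, ha⟩ := h.surjective φ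
      exact ⟨a, funext fun i => LinearMap.ext (ha i)⟩⟩

/-- The action map of a complete family, as a linear equivalence. -/
noncomputable def linearEquiv [∀ i, IsScalarTower K A (V i)] (h : IsComplete K A V) :
    A ≃ₗ[K] ∀ i, Module.End K (V i) :=
  h.equiv.toAddEquiv.toLinearEquiv fun c a => funext fun _ => LinearMap.ext fun v =>
    smul_assoc c a v

lemma isSemisimpleRing [Finite ι] [∀ i, IsScalarTower K A (V i)] (h : IsComplete K A V) :
    IsSemisimpleRing A := by
  have h1 : ∀ i, IsSemisimpleRing (Module.End K (V i)) := fun i =>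
    haveI := h.finite i
    IsSemisimpleRing.moduleEnd K (V i)
  exact h.equiv.symm.isSemisimpleRing

/-- The operators of rank one with a fixed functional form a left ideal isomorphic to `V i`. Such
left ideals generate `A`, so one of them acts nontrivially on a given nonzero `m`, and Schur's lemma
applies. -/
lemma exists_linearEquiv [Finite ι] [∀ i, IsScalarTower K A (V i)] (h : IsComplete K A V)
    (M : Type*) [AddCommGroup M] [Module A M] [IsSimpleModule A M] :
    ∃ i, Nonempty (V i ≃ₗ[A] M) := by
  classical
  cases nonempty_fintype ι
  obtain ⟨m, hm⟩ := @exists_ne M (IsSimpleModule.nontrivial A M) 0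
  by_contra! hne
  apply hm
  have h2 := fun i => (h.simple i)
  have := h.finite
  let b := fun i => Module.finBasis K (V i)
  -- `a i (w, l)` acts on `V i` as `v ↦ l(v) w` and as zero on the other members.
  choose a ha ha' using fun i (p : V i × (V i →ₗ[K] K)) =>
    h.exists_single i (p.2.smulRight p.1)
  have hab : ∀ i l (c : A) (w : V i), a i (c • w, l) = c * a i (w, l) := by
    intro i l c w
    refine h.ext fun j v => ?_
    rw [mul_smul]
    rcases eq_or_ne j i with rfl | hj
    · rw [ha, ha]
      exact (smul_algebra_smul_comm (l v) c w).symm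
    · simp [ha' _ _ _ hj]
  have hadd : ∀ i l (w w' : V i), a i (w + w', l) = a i (w, l) + a i (w', l) := by
    intro i l w w'
    refine h.ext fun j v => ?_
    rw [add_smul]
    rcases eq_or_ne j i with rfl | hj
    · simp [ha]
    · simp [ha' _ _ _ hj]
  have h0 : ∀ i l w, a i (w, l) • m = 0 := by
    intro i l w
    let F : V i →ₗ[A] M :=
      { toFun := fun w => a i (w, l) • m
        map_add' := fun w w' => by rw [hadd, add_smul]
        map_smul' := fun c w => by rw [hab, mul_smul]; rfl }
    rcases LinearMap.bijective_or_eq_zero F with hF | hF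
    · exact ((hne i).false (LinearEquiv.ofBijective F hF)).elim
    · exact LinearMap.congr_fun hF w
  -- The expansion in a basis writes the identity of each factor as a sum of rank one operators, all
  -- of which kill `m` by `h0`; so `m = 1 • m = 0`.
  have h1 : (1 : A) = ∑ i, ∑ k, a i (b i k, (b i).coord k) := by
    refine h.ext fun j v => ?_
    rw [one_smul, Finset.sum_smul, Finset.sum_eq_single j]
    · simp only [Finset.sum_smul, ha, LinearMap.smulRight_apply, Module.Basis.coord_apply]
      exact ((b j).sum_repr v).symm
    · intro i _ hij
      simp [Finset.sum_smul, ha' _ _ _ (Ne.symm hij)]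
    · simp
  rw [← one_smul A m, h1]
  simp [Finset.sum_smul, h0]

lemma of_linearEquiv [∀ i, IsScalarTower K A (V i)] (h : IsComplete K A V) {κ : Type*}
    (W : κ → Type*) [∀ j, AddCommGroup (W j)] [∀ j, Module K (W j)] [∀ j, Module A (W j)]
    [∀ j, IsScalarTower K A (W j)] (σ : κ ≃ ι) (e : ∀ j, W j ≃ₗ[A] V (σ j)) :
    IsComplete K A W := by
  let e' := fun j => (e j).restrictScalars K
  refine ⟨fun j => ?_, fun j => ?_, fun a ha => h.injective a fun i v => ?_, fun φ => ?_⟩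
  · have := h.finite (σ j)
    exact Module.Finite.equiv (e' j).symm
  · have := h.nontrivial (σ j)
    exact (e j).toEquiv.nontrivial
  · obtain ⟨j, rfl⟩ := σ.surjective i
    obtain ⟨w, rfl⟩ := (e j).surjective v
    rw [← map_smul, ha, map_zero]
  · let ψ : ∀ j, V (σ j) →ₗ[K] V (σ j) := fun j => (e' j).conj (φ j)
    -- The cast only identifies the index `σ (σ.symm i)` with `i`.
    obtain ⟨a, ha⟩ := h.surjective (fun i => cast (by rw [σ.apply_symm_apply]) (ψ (σ.symm i)))
    refine ⟨a, fun j w => (e j).injective ?_⟩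
    rw [map_smul, ha]
    have h1 : ∀ k, k = j → ∀ hc, (cast hc (ψ k) : V (σ j) →ₗ[K] V (σ j)) = ψ j := by
      rintro k rfl hc
      rfl
    rw [h1 _ (σ.symm_apply_apply j)]
    simp [ψ, e', LinearEquiv.conj_apply]

end IsComplete

/-! ### Modules from representations, and existence of complete families (Wedderburn–Artin). -/

/-- A representation of `A` on a `K`-space `L` as an `A`-module. -/
def repMod {K A L : Type u} [Field K] [Ring A] [Algebra K A] [AddCommGroup L] [Module K L]
    (ρ : A →ₐ[K] Module.End K L) : ModuleCat.{u} A :=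
  @ModuleCat.of A _ L _ (Module.compHom L ρ.toRingHom)

/-- The identity map from `L` to the module of a representation on `L`. -/
def repEquiv {K A L : Type u} [Field K] [Ring A] [Algebra K A] [AddCommGroup L] [Module K L]
    (ρ : A →ₐ[K] Module.End K L) : L ≃ₗ[K] repMod ρ :=
  { toFun := fun l => l
    invFun := fun l => l
    map_add' := fun _ _ => rfl
    -- On `repMod ρ` scalars act through `algebraMap K A`, on `L` by its own structure; `ρ.commutes`
    -- reconciles the two.
    map_smul' := fun c l => (LinearMap.congr_fun (ρ.commutes c) l).symm
    left_inv := fun _ => rfl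
    right_inv := fun _ => rfl }

lemma smul_repEquiv {K A L : Type u} [Field K] [Ring A] [Algebra K A] [AddCommGroup L]
    [Module K L] (ρ : A →ₐ[K] Module.End K L) (a : A) (l : L) :
    a • repEquiv ρ l = repEquiv ρ (ρ a l) := rfl

lemma isComplete_repMod {K A : Type u} [Field K] [Ring A] [Algebra K A] {ι : Type*}
    {L : ι → Type u} [∀ i, AddCommGroup (L i)] [∀ i, Module K (L i)]
    [∀ i, Module.Finite K (L i)] [∀ i, Nontrivial (L i)]
    (ρ : ∀ i, A →ₐ[K] Module.End K (L i)) (hinj : ∀ a, (∀ i, ρ i a = 0) → a = 0)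
    (hsurj : ∀ φ : ∀ i, Module.End K (L i), ∃ a, ∀ i, ρ i a = φ i) :
    IsComplete K A (fun i => repMod (ρ i)) := by
  refine ⟨fun i => Module.Finite.equiv (repEquiv (ρ i)), fun i =>
    (repEquiv (ρ i)).symm.toEquiv.nontrivial, fun a ha => hinj a fun i => LinearMap.ext fun v =>
      (repEquiv (ρ i)).injective (ha i (repEquiv (ρ i) v)), fun φ => ?_⟩
  obtain ⟨a, ha⟩ := hsurj fun i => (repEquiv (ρ i)).symm.conj (φ i)
  refine ⟨a, fun i v => ?_⟩
  obtain ⟨v, rfl⟩ := (repEquiv (ρ i)).surjective v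
  rw [smul_repEquiv, ha]
  simp [LinearEquiv.conj_apply]

/-- Wedderburn–Artin gives matrix rings over the opposite endomorphism rings of simple left ideals.
The splitting hypothesis turns these division rings into `K`, and the family consists of the column
spaces `K^d`. -/
lemma exists_isComplete (K A : Type u) [Field K] [Ring A] [Algebra K A] [IsSemisimpleRing A]
    (hA : ∀ I : Ideal A, IsSimpleModule A I → ∀ f : I →ₗ[A] I, ∃ c : K, ∀ m, f m = c • m) :
    ∃ (n : ℕ) (V : Fin n → ModuleCat.{u} A), IsComplete K A (fun i => V i) := by
  obtain ⟨n, S, d, hS, hd, ⟨e⟩⟩ := IsSemisimpleRing.exists_algEquiv_pi_matrix_end_mulOpposite K A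
  have hK : ∀ i, Function.Bijective (algebraMap K (Module.End A (S i))ᵐᵒᵖ) := fun i =>
    ⟨by
      have := IsSimpleModule.nontrivial A (S i)
      exact (algebraMap K (Module.End A (S i))ᵐᵒᵖ).injective, fun f => by
      obtain ⟨c, hc⟩ := hA (S i) (hS i) f.unop
      exact ⟨c, MulOpposite.unop_injective (LinearMap.ext fun m => (hc m).symm)⟩⟩
  let k := fun i => AlgEquiv.ofBijective (Algebra.ofId K (Module.End A (S i))ᵐᵒᵖ) (hK i)
  let e' : A ≃ₐ[K] ∀ i, Module.End K (Fin (d i) → K) :=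
    e.trans (AlgEquiv.piCongrRight fun i => (k i).symm.mapMatrix.trans Matrix.toLinAlgEquiv')
  refine ⟨n, _, isComplete_repMod
    (fun i => (Pi.evalAlgHom K (fun i => Module.End K (Fin (d i) → K)) i).comp
      (e' : A →ₐ[K] ∀ i, Module.End K (Fin (d i) → K))) (fun a ha => ?_) fun φ => ?_⟩
  · apply e'.injective
    rw [map_zero]
    exact funext ha
  · exact ⟨e'.symm φ, fun i => congrFun (e'.apply_symm_apply φ) i⟩

namespace GAlgebra

variable {K : Type u} [Field K] {G : Type v} [Group G] {A : GAlgebra.{u, v} K G}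

/-! ### Recognising `Irr(A)` -/

lemma isSemisimpleSplit_of_isComplete {ι : Type*} [Finite ι] {V : ι → Type u}
    [∀ i, AddCommGroup (V i)] [∀ i, Module K (V i)] [∀ i, Module A.carrier (V i)]
    [∀ i, IsScalarTower K A.carrier (V i)] (h : IsComplete K A.carrier V) :
    A.IsSemisimpleSplit := by
  refine ⟨h.isSemisimpleRing, fun M hM => ⟨hM, fun f => ?_⟩⟩
  obtain ⟨i, ⟨e⟩⟩ := h.exists_linearEquiv M
  obtain ⟨c, hc⟩ := h.endo i (e.symm.toLinearMap ∘ₗ f ∘ₗ e.toLinearMap)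
  refine ⟨c, fun m => ?_⟩
  have h1 := congrArg e (hc (e.symm m))
  rw [← algebraMap_smul A.carrier c, map_smul] at h1
  simpa using h1

lemma isAbsSimple_of_isComplete {ι : Type*} {V : ι → Type u}
    [∀ i, AddCommGroup (V i)] [∀ i, Module K (V i)] [∀ i, Module A.carrier (V i)]
    [∀ i, IsScalarTower K A.carrier (V i)] (h : IsComplete K A.carrier V) (i : ι) :
    A.IsAbsSimple (ModuleCat.of A.carrier (V i)) :=
  ⟨h.simple i, fun f => by
    obtain ⟨c, hc⟩ := h.endo i f
    exact ⟨c, fun m => (hc m).trans (algebraMap_smul A.carrier c (show V i from m)).symm⟩⟩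

/-- The members of a complete family, as absolutely simple modules. -/
def completeFamily {ι : Type*} {V : ι → Type u}
    [∀ i, AddCommGroup (V i)] [∀ i, Module K (V i)] [∀ i, Module A.carrier (V i)]
    [∀ i, IsScalarTower K A.carrier (V i)] (h : IsComplete K A.carrier V) (i : ι) : A.AbsSimple :=
  ⟨ModuleCat.of A.carrier (V i), isAbsSimple_of_isComplete h i⟩

/-- The module underlying an absolutely simple module. -/
def AbsSimple.mod (M : A.AbsSimple) : ModuleCat.{u} A.carrier := M.1

/-- The class of an absolutely simple module. -/
def AbsSimple.cls (M : A.AbsSimple) : A.IrrSet := Quotient.mk _ M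

lemma AbsSimple.cls_eq_iff {M N : A.AbsSimple} :
    M.cls = N.cls ↔ Nonempty (M.mod ≃ₗ[A.carrier] N.mod) :=
  Quotient.eq (r := A.absSimpleSetoid)

/-- The chosen representative of a class in `Irr(A)`. -/
noncomputable def irrRep (x : A.IrrSet) : A.AbsSimple := Quotient.out x

lemma cls_irrRep (x : A.IrrSet) : (irrRep x).cls = x := Quotient.out_eq x

lemma bijective_cls_of_isComplete {ι : Type*} [Finite ι] {V : ι → Type u}
    [∀ i, AddCommGroup (V i)] [∀ i, Module K (V i)] [∀ i, Module A.carrier (V i)]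
    [∀ i, IsScalarTower K A.carrier (V i)] (h : IsComplete K A.carrier V) :
    Function.Bijective (fun i => (completeFamily h i).cls) := by
  refine ⟨fun i j hij => ?_, fun x => ?_⟩
  · obtain ⟨e⟩ := AbsSimple.cls_eq_iff.mp hij
    exact h.eq_of_linearEquiv e
  · obtain ⟨M, rfl⟩ := Quotient.exists_rep x
    have := M.2.simple
    obtain ⟨i, ⟨e⟩⟩ := h.exists_linearEquiv M.1
    exact ⟨i, AbsSimple.cls_eq_iff.mpr ⟨e⟩⟩

lemma IsSemisimpleSplit.exists_isComplete (hA : A.IsSemisimpleSplit) :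
    ∃ (n : ℕ) (V : Fin n → ModuleCat.{u} A.carrier), IsComplete K A.carrier (fun i => V i) := by
  have := hA.semisimple
  refine GMorita.exists_isComplete K A.carrier fun I hI f => ?_
  obtain ⟨c, hc⟩ := (hA.split (ModuleCat.of A.carrier I) hI).endo f
  exact ⟨c, fun m => (hc m).trans (algebraMap_smul A.carrier c m)⟩

lemma IsSemisimpleSplit.finite_irr (hA : A.IsSemisimpleSplit) : Finite A.IrrSet := by
  obtain ⟨n, V, hV⟩ := hA.exists_isComplete
  exact Finite.of_surjective _ (bijective_cls_of_isComplete hV).2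

lemma IsSemisimpleSplit.isComplete_of_bijective (hA : A.IsSemisimpleSplit) {κ : Type*}
    (W : κ → A.AbsSimple) (hW : Function.Bijective (fun j => (W j).cls)) :
    IsComplete K A.carrier (fun j => (W j).mod) := by
  obtain ⟨n, V, hV⟩ := hA.exists_isComplete
  let σ : κ ≃ Fin n := (Equiv.ofBijective _ hW).trans
    (Equiv.ofBijective _ (bijective_cls_of_isComplete hV)).symm
  have h1 : ∀ j, (W j).cls = (completeFamily hV (σ j)).cls := fun j =>
    ((Equiv.ofBijective _ (bijective_cls_of_isComplete hV)).apply_symm_apply _).symm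
  exact hV.of_linearEquiv (fun j => (W j).mod) σ fun j => (AbsSimple.cls_eq_iff.mp (h1 j)).some

/-- `S : M → N` is semilinear for `g`: `S (a m) = g(a) S m`. -/
def IsSemilinear (g : G) {M N : Type*} [AddCommGroup M] [AddCommGroup N] [Module A.carrier M]
    [Module A.carrier N] (S : M ≃+ N) : Prop :=
  ∀ (a : A.carrier) (m : M), S (a • m) = (g • a) • S m

lemma IsSemilinear.symm {g : G} {M N : Type*} [AddCommGroup M] [AddCommGroup N]
    [Module A.carrier M] [Module A.carrier N] {S : M ≃+ N} (hS : IsSemilinear (A := A) g S)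
    (a : A.carrier) (n : N) : S.symm (a • n) = (g⁻¹ • a) • S.symm n := by
  apply S.injective
  rw [hS, S.apply_symm_apply, S.apply_symm_apply, smul_inv_smul]

/-- On underlying groups, an `A`-linear isomorphism `M^[g⁻¹] ≅ N` is the same thing as a
`g`-semilinear bijection `M → N`. -/
lemma smul_cls_eq_iff {g : G} {M N : A.AbsSimple} :
    g • M.cls = N.cls ↔ ∃ S : M.mod ≃+ N.mod, IsSemilinear (A := A) g S := by
  have h0 : g • M.cls = AbsSimple.cls ⟨(A.twist g⁻¹).obj M.1, M.2.twist g⁻¹⟩ := rfl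
  refine (iff_of_eq (congrArg (· = N.cls) h0)).trans (AbsSimple.cls_eq_iff.trans ?_)
  constructor
  · rintro ⟨e⟩
    refine ⟨e.toAddEquiv, fun a m => ?_⟩
    refine Eq.trans ?_ (e.map_smul (g • a) m)
    change e (a • (show M.mod from m)) = e ((g⁻¹ • g • a) • (show M.mod from m))
    rw [inv_smul_smul]
  · rintro ⟨S, hS⟩
    refine ⟨{ S with map_smul' := fun a m => ?_ }⟩
    refine (hS (g⁻¹ • a) m).trans ?_
    rw [smul_inv_smul]
    rfl

lemma IsObstruction.restrict {M : ModuleCat.{u} A.carrier} {H L : Subgroup G} {θ : Z2 H K}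
    (h : IsObstruction M H θ) (hL : ∀ a ∈ L, (1 : G) * a * 1⁻¹ ∈ H) :
    IsObstruction M L (Z2.comap K (conjHom 1 L H hL) θ) := by
  obtain ⟨T, hT, hθ⟩ := h
  refine ⟨fun l => T (conjHom 1 L H hL l), fun l a m => ?_, fun l k m => ?_⟩
  · rw [hT]
    simp [conjHom]
  · simp only [hθ, map_mul]
    rfl

/-- Recognition principle used for all three operations, for invariance and for realisation. The
semilinear maps need no compatibility with each other; they only show that `x ↦ [V x]` is
equivariant. -/
lemma isomorphic_irr {X : DecSet.{u, v, u + 1} K G} (V : X.carrier → A.AbsSimple)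
    (hV : Function.Bijective (fun x => (V x).cls))
    (hS : ∀ (g : G) (x : X.carrier),
      ∃ S : (V x).mod ≃+ (V (g • x)).mod, IsSemilinear (A := A) g S)
    (hθ : ∀ x : X.carrier, ∃ θ : Z2 (stab G x) K,
      IsObstruction (V x).mod (stab G x) θ ∧ X.frill x = QuotientGroup.mk θ) :
    DecSet.Isomorphic X A.Irr := by
  have hf : ∀ (g : G) (x : X.carrier), (V (g • x)).cls = g • (V x).cls := fun g x =>
    (smul_cls_eq_iff.mpr (hS g x)).symm
  refine ⟨Equiv.ofBijective _ hV, hf, fun x => ?_⟩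
  obtain ⟨θ, h1, h2⟩ := hθ x
  -- `θ'` lives on the stabiliser of the class `[V x]` and `θ` on that of `x`. On the latter both
  -- are obstruction cocycles of one module, hence cohomologous.
  obtain ⟨θ', h3⟩ := exists_isObstruction (V x).2 _ (exists_semilinear_of_mem_stab (V x) _ rfl)
  have h4 : A.Irr.frill (V x).cls = QuotientGroup.mk θ' := irrFrill_eq _ (V x) rfl θ' h3
  rw [h2]
  refine Eq.trans ?_ (congrArg (muConj K 1 _ _ (conj_one (stab_map_le hf x))) h4).symm
  exact isObstruction_unique (V x).2 h1 (h3.restrict _)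

lemma exists_isSemilinear_out (g : G) (x : A.IrrSet) :
    ∃ S : (irrRep x).mod ≃+ (irrRep (g • x)).mod, IsSemilinear (A := A) g S := by
  rw [← smul_cls_eq_iff, cls_irrRep, cls_irrRep]

lemma exists_isObstruction_out (x : A.IrrSet) : ∃ θ : Z2 (stab G x) K,
    IsObstruction (irrRep x).mod (stab G x) θ ∧ A.Irr.frill x = QuotientGroup.mk θ :=
  ⟨_, Classical.choose_spec (exists_isObstruction_rep x), rfl⟩

lemma IsSemisimpleSplit.isComplete_out (hA : A.IsSemisimpleSplit) :
    IsComplete K A.carrier (fun x : A.IrrSet => (irrRep x).mod) := by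
  refine hA.isComplete_of_bijective irrRep ?_
  exact ⟨fun x y h => (cls_irrRep x).symm.trans (h.trans (cls_irrRep y)),
    fun x => ⟨x, cls_irrRep x⟩⟩

end GAlgebra

namespace GAlgebra

variable {K : Type u} [Field K] {G : Type v} [Group G] {A B : GAlgebra.{u, v} K G}

/-! ### `K`-linear form of semilinear maps and obstructions -/

/-- `G` fixes the scalars inside `A`, so semilinear maps are automatically `K`-linear. This allows
dualising and tensoring them. -/
lemma IsSemilinear.exists_linearEquiv {g : G} {M N : ModuleCat.{u} A.carrier} {S : M ≃+ N}
    (hS : IsSemilinear (A := A) g S) :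
    ∃ S' : M ≃ₗ[K] N, ∀ (a : A.carrier) (m : M), S' (a • m) = (g • a) • S' m :=
  ⟨S.toLinearEquiv fun c m =>
    (hS (algebraMap K A.carrier c) m).trans (congrArg (· • S m) (smul_algebraMap' g c)), hS⟩

lemma IsObstruction.exists_linearEquiv {M : ModuleCat.{u} A.carrier} {H : Subgroup G}
    {θ : Z2 H K} (h : IsObstruction M H θ) :
    ∃ T : H → (M ≃ₗ[K] M),
      (∀ (h : H) (a : A.carrier) (m : M), T h (a • m) = ((h : G) • a) • T h m) ∧
      ∀ (g h : H) (m : M), T g (T h m) = (θ.1 (g, h) : K) • T (g * h) m := by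
  obtain ⟨T, hT, hθ⟩ := h
  exact ⟨fun h => (T h).toLinearEquiv fun c m =>
    (hT h (algebraMap K A.carrier c) m).trans (congrArg (· • T h m) (smul_algebraMap' (h : G) c)),
    hT, hθ⟩

section repMod

variable {L L' : Type u} [AddCommGroup L] [Module K L] [AddCommGroup L'] [Module K L']

lemma isSemilinear_repMod {ρ : A.carrier →ₐ[K] Module.End K L}
    {ρ' : A.carrier →ₐ[K] Module.End K L'} {g : G} (S : L ≃ₗ[K] L')
    (hS : ∀ (a : A.carrier) (l : L), S (ρ a l) = ρ' (g • a) (S l)) :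
    ∃ S : repMod ρ ≃+ repMod ρ', IsSemilinear (A := A) g S :=
  ⟨((repEquiv ρ).symm.trans (S.trans (repEquiv ρ'))).toAddEquiv, hS⟩

lemma isObstruction_repMod {ρ : A.carrier →ₐ[K] Module.End K L} {H : Subgroup G} {θ : Z2 H K}
    (T : H → (L ≃ₗ[K] L))
    (hT : ∀ (h : H) (a : A.carrier) (l : L), T h (ρ a l) = ρ ((h : G) • a) (T h l))
    (hθ : ∀ (g h : H) (l : L), T g (T h l) = (θ.1 (g, h) : K) • T (g * h) l) :
    IsObstruction (repMod ρ) H θ := by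
  refine ⟨fun h => ((repEquiv ρ).symm.trans ((T h).trans (repEquiv ρ))).toAddEquiv, hT,
    fun g h m => ?_⟩
  refine (hθ g h m).trans ?_
  exact (LinearMap.congr_fun (ρ.commutes (θ.1 (g, h) : K)) _).symm

end repMod

/-! ### The opposite algebra -/

section opposite

/-- The contragredient representation of the opposite algebra. -/
def dualRep (M : ModuleCat.{u} A.carrier) :
    A.opposite.carrier →ₐ[K] Module.End K (Module.Dual K M) where
  toFun a := (Algebra.lsmul K K M (MulOpposite.unop a)).dualMap
  map_one' := by ext f m; exact congrArg f (one_smul A.carrier m)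
  map_mul' a b := by
    ext f m
    exact congrArg f (mul_smul (MulOpposite.unop b) (MulOpposite.unop a) m)
  map_zero' := by
    ext f m
    exact (congrArg f (zero_smul A.carrier m)).trans (map_zero f)
  map_add' a b := by
    ext f m
    exact (congrArg f (add_smul (MulOpposite.unop a) (MulOpposite.unop b) m)).trans (map_add f _ _)
  commutes' c := by ext f m; exact f.map_smul c m

/-- Functionals separate points, which gives faithfulness. By reflexivity every operator on the dual
is a transpose, which gives surjectivity. -/
lemma isComplete_dual {ι : Type*} [Finite ι] {V : ι → ModuleCat.{u} A.carrier}
    (h : IsComplete K A.carrier (fun i => V i)) :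
    IsComplete K A.opposite.carrier (fun i => repMod (dualRep (V i))) := by
  have h1 := h.finite
  have h2 := h.nontrivial
  refine isComplete_repMod _ (fun a ha => ?_) fun φ => ?_
  · refine MulOpposite.unop_injective ?_
    refine h.injective _ fun i v => ?_
    rw [← Module.forall_dual_apply_eq_zero_iff K]
    intro f
    exact LinearMap.congr_fun (LinearMap.congr_fun (ha i) f) v
  · obtain ⟨a, ha⟩ := h.surjective fun i =>
      (Module.evalEquiv K (V i)).symm.toLinearMap ∘ₗ (φ i).dualMap ∘ₗ Module.Dual.eval K (V i)
    refine ⟨MulOpposite.op a, fun i => LinearMap.ext fun f => LinearMap.ext fun v => ?_⟩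
    refine (congrArg f (ha i v)).trans ?_
    simp

/-- The lifts are the transposes of `(T h)⁻¹`. Inversion and transposition each reverse products, so
the order is preserved and only the scalar is inverted. -/
lemma IsObstruction.dual {M : ModuleCat.{u} A.carrier} {H : Subgroup G} {θ : Z2 H K}
    (h : IsObstruction M H θ) : IsObstruction (repMod (dualRep M)) H θ⁻¹ := by
  obtain ⟨T, h1, h2⟩ := h.exists_linearEquiv
  refine isObstruction_repMod (ρ := dualRep M)
    (fun h => (T h).symm.dualMap) (fun h a f => ?_) fun g h f => ?_
  · refine LinearMap.ext fun m => ?_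
    obtain ⟨m, rfl⟩ := (T h).surjective m
    refine (congrArg f ?_).trans (congrArg f ((T h).symm_apply_eq.mpr (h1 h a.unop m).symm)).symm
    exact congrArg _ ((T h).symm_apply_apply m)
  · refine LinearMap.ext fun m => ?_
    obtain ⟨m, rfl⟩ := (T (g * h)).surjective m
    have h3 : (θ.1 (g, h) : K) ≠ 0 := (θ.1 (g, h)).ne_zero
    have h4 : T (g * h) m = (θ.1 (g, h) : K)⁻¹ • T g (T h m) := by
      rw [h2, smul_smul, inv_mul_cancel₀ h3, one_smul]
    have h5 : (T h).symm ((T g).symm (T (g * h) m)) = (θ.1 (g, h) : K)⁻¹ • m := by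
      rw [h4, map_smul, map_smul, LinearEquiv.symm_apply_apply, LinearEquiv.symm_apply_apply]
    refine (congrArg f h5).trans ((f.map_smul _ m).trans ?_)
    refine (congrArg₂ (· * ·) (Units.val_inv_eq_inv_val _).symm ?_)
    exact congrArg f ((T (g * h)).symm_apply_apply m).symm

lemma IsSemisimpleSplit.opposite (hA : A.IsSemisimpleSplit) : A.opposite.IsSemisimpleSplit :=
  have := hA.finite_irr
  isSemisimpleSplit_of_isComplete (isComplete_dual hA.isComplete_out)

lemma dual_isomorphic_irr (hA : A.IsSemisimpleSplit) :
    DecSet.Isomorphic A.Irr.dual A.opposite.Irr := by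
  have := hA.finite_irr
  have hc := isComplete_dual hA.isComplete_out
  refine isomorphic_irr (X := A.Irr.dual) (fun x : A.IrrSet => completeFamily hc x)
    (bijective_cls_of_isComplete hc) (fun g (x : A.IrrSet) => ?_) fun x : A.IrrSet => ?_
  · obtain ⟨S, hS⟩ := exists_isSemilinear_out g x
    obtain ⟨S', hS'⟩ := IsSemilinear.exists_linearEquiv hS
    refine isSemilinear_repMod (ρ := dualRep (irrRep x).mod)
      (ρ' := dualRep (irrRep (g • x)).mod) S'.symm.dualMap fun a f => LinearMap.ext fun m => ?_
    obtain ⟨m, rfl⟩ := S'.surjective m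
    refine (congrArg f ?_).trans (congrArg f (S'.symm_apply_eq.mpr (hS' a.unop m).symm)).symm
    exact congrArg _ (S'.symm_apply_apply m)
  · obtain ⟨θ, h, hθ⟩ := exists_isObstruction_out x
    exact ⟨θ⁻¹, h.dual, congrArg (·⁻¹) hθ⟩

end opposite

/-! ### The direct sum -/

section directSum

/-- Pull-back of a module along an algebra homomorphism. -/
abbrev pullRep {C D : GAlgebra.{u, v} K G} (π : C.carrier →ₐ[K] D.carrier)
    (M : ModuleCat.{u} D.carrier) : C.carrier →ₐ[K] Module.End K M :=
  (Algebra.lsmul K K M).comp π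

/-- The first projection of a direct sum. -/
def fstHom (A B : GAlgebra.{u, v} K G) : (A.directSum B).carrier →ₐ[K] A.carrier :=
  AlgHom.fst K A.carrier B.carrier

/-- The second projection of a direct sum. -/
def sndHom (A B : GAlgebra.{u, v} K G) : (A.directSum B).carrier →ₐ[K] B.carrier :=
  AlgHom.snd K A.carrier B.carrier

/-- The disjoint union of a family of `A`-modules and a family of `B`-modules. -/
def sumFamily {ι κ : Type*} (V : ι → ModuleCat.{u} A.carrier) (W : κ → ModuleCat.{u} B.carrier) :
    ι ⊕ κ → ModuleCat.{u} (A.directSum B).carrier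
  | Sum.inl i => repMod (pullRep (fstHom A B) (V i))
  | Sum.inr j => repMod (pullRep (sndHom A B) (W j))

lemma isComplete_sum {ι κ : Type*} {V : ι → ModuleCat.{u} A.carrier}
    {W : κ → ModuleCat.{u} B.carrier} (hV : IsComplete K A.carrier (fun i => V i))
    (hW : IsComplete K B.carrier (fun i => W i)) :
    IsComplete K (A.directSum B).carrier (fun s => sumFamily V W s) := by
  refine ⟨?_, ?_, fun c hc => ?_, fun φ => ?_⟩
  · rintro (i | j)
    · have := hV.finite i
      exact Module.Finite.equiv (repEquiv (pullRep (fstHom A B) (V i)))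
    · have := hW.finite j
      exact Module.Finite.equiv (repEquiv (pullRep (sndHom A B) (W j)))
  · rintro (i | j)
    · exact hV.nontrivial i
    · exact hW.nontrivial j
  · exact Prod.ext (hV.injective _ fun i v => hc (Sum.inl i) v)
      (hW.injective _ fun i v => hc (Sum.inr i) v)
  · obtain ⟨a, ha⟩ := hV.surjective fun i =>
      (repEquiv (pullRep (fstHom A B) (V i))).symm.conj (φ (Sum.inl i))
    obtain ⟨b, hb⟩ := hW.surjective fun i =>
      (repEquiv (pullRep (sndHom A B) (W i))).symm.conj (φ (Sum.inr i))
    refine ⟨(a, b), ?_⟩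
    rintro (i | j) v
    · exact ha i v
    · exact hb j v

lemma IsSemisimpleSplit.directSum (hA : A.IsSemisimpleSplit) (hB : B.IsSemisimpleSplit) :
    (A.directSum B).IsSemisimpleSplit :=
  have := hA.finite_irr
  have := hB.finite_irr
  isSemisimpleSplit_of_isComplete (isComplete_sum hA.isComplete_out hB.isComplete_out)

lemma sum_isomorphic_irr (hA : A.IsSemisimpleSplit) (hB : B.IsSemisimpleSplit) :
    DecSet.Isomorphic (A.Irr.sum B.Irr) (A.directSum B).Irr := by
  have := hA.finite_irr
  have := hB.finite_irr
  have hc := isComplete_sum hA.isComplete_out hB.isComplete_out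
  refine isomorphic_irr (X := A.Irr.sum B.Irr)
    (fun x : A.IrrSet ⊕ B.IrrSet => completeFamily hc x)
    (bijective_cls_of_isComplete hc) ?_ ?_
  · rintro g (x | x)
    · obtain ⟨S, hS⟩ := exists_isSemilinear_out g (x : A.IrrSet)
      exact ⟨S, fun c m => hS c.1 m⟩
    · obtain ⟨S, hS⟩ := exists_isSemilinear_out g (x : B.IrrSet)
      exact ⟨S, fun c m => hS c.2 m⟩
  · rintro (x | x)
    · obtain ⟨θ, h, hθ⟩ := exists_isObstruction_out (x : A.IrrSet)
      refine ⟨_, ?_, congrArg (muConj K 1 _ (stab G x) (conj_one (DecSet.stab_inl (G := G) (X := A.IrrSet) (Y := B.IrrSet) x))) hθ⟩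
      obtain ⟨T, h1, h2⟩ := h.restrict (conj_one (DecSet.stab_inl (G := G) (X := A.IrrSet) (Y := B.IrrSet) x))
      exact ⟨T, fun h c m => h1 h c.1 m, h2⟩
    · obtain ⟨θ, h, hθ⟩ := exists_isObstruction_out (x : B.IrrSet)
      refine ⟨_, ?_, congrArg (muConj K 1 _ (stab G x) (conj_one (DecSet.stab_inr (G := G) (X := A.IrrSet) (Y := B.IrrSet) x))) hθ⟩
      obtain ⟨T, h1, h2⟩ := h.restrict (conj_one (DecSet.stab_inr (G := G) (X := A.IrrSet) (Y := B.IrrSet) x))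
      exact ⟨T, fun h c m => h1 h c.2 m, h2⟩

end directSum

/-! ### The tensor product -/

section tensor

/-- The representation of `A ⊗ B` on `M ⊗ N`. -/
def tensorRep (M : ModuleCat.{u} A.carrier) (N : ModuleCat.{u} B.carrier) :
    (A.tensor B).carrier →ₐ[K] Module.End K (M ⊗[K] N) :=
  (Module.endTensorEndAlgHom (R := K) (A := K) (M := M) (N := N)).comp
    (Algebra.TensorProduct.map (Algebra.lsmul K K M) (Algebra.lsmul K K N))

lemma tensorRep_tmul (M : ModuleCat.{u} A.carrier) (N : ModuleCat.{u} B.carrier) (a : A.carrier)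
    (b : B.carrier) (m : M) (n : N) :
    tensorRep M N (a ⊗ₜ[K] b : A.carrier ⊗[K] B.carrier) (m ⊗ₜ n) = (a • m) ⊗ₜ (b • n) := rfl

lemma tensorRep_smul (g : G) {M M' : ModuleCat.{u} A.carrier} {N N' : ModuleCat.{u} B.carrier}
    (S : M ≃ₗ[K] M') (S' : N ≃ₗ[K] N') (hS : ∀ (a : A.carrier) (m : M), S (a • m) = (g • a) • S m)
    (hS' : ∀ (b : B.carrier) (n : N), S' (b • n) = (g • b) • S' n) (c : (A.tensor B).carrier)
    (l : M ⊗[K] N) :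
    TensorProduct.congr S S' (tensorRep M N c l) =
      tensorRep M' N' (g • c) (TensorProduct.congr S S' l) := by
  induction c using TensorProduct.induction_on with
  | zero =>
    refine (congrArg (fun F => TensorProduct.congr S S' (F l)) (map_zero (tensorRep M N))).trans ?_
    refine (map_zero (TensorProduct.congr S S')).trans (Eq.symm ?_)
    exact congrArg (fun F => F (TensorProduct.congr S S' l))
      ((congrArg (tensorRep M' N') (smul_zero (A := (A.tensor B).carrier) g)).trans (map_zero (tensorRep M' N')))
  | add c d hc hd =>
    refine (congrArg (fun F => TensorProduct.congr S S' (F l)) (map_add (tensorRep M N) c d)).trans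
      ((map_add (TensorProduct.congr S S') _ _).trans ((congrArg₂ (· + ·) hc hd).trans
        (Eq.symm ?_)))
    exact congrArg (fun F => F (TensorProduct.congr S S' l))
      ((congrArg (tensorRep M' N') (smul_add (A := (A.tensor B).carrier) g c d)).trans (map_add (tensorRep M' N') _ _))
  | tmul a b =>
    induction l using TensorProduct.induction_on with
    | zero => simp
    | add l l' h h' => simp only [map_add, h, h']
    | tmul m n =>
      change (S (a • m)) ⊗ₜ[K] (S' (b • n)) = ((g • a) • S m) ⊗ₜ[K] ((g • b) • S' n)
      rw [hS, hS']

/-- `End(V ⊗ W)` is spanned by operators `f ⊗ f'`. Each is realised by `a ⊗ b` with `a` and `b`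
supported on a single factor, which also makes it vanish at all other pairs of indices. -/
lemma isComplete_tensor {ι κ : Type*} [Finite ι] [Finite κ] {V : ι → ModuleCat.{u} A.carrier}
    {W : κ → ModuleCat.{u} B.carrier} (hV : IsComplete K A.carrier (fun i => V i))
    (hW : IsComplete K B.carrier (fun i => W i)) :
    IsComplete K (A.tensor B).carrier
      (fun p : ι × κ => repMod (tensorRep (V p.1) (W p.2))) := by
  classical
  cases nonempty_fintype ι
  cases nonempty_fintype κ
  have h1 := hV.finite
  have h2 := hV.nontrivial
  have h3 := hW.finite
  have h4 := hW.nontrivial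
  let Ψ : (A.carrier ⊗[K] B.carrier) →ₐ[K] ∀ p : ι × κ, Module.End K (V p.1 ⊗[K] W p.2) :=
    AlgHom.pi fun p => tensorRep (V p.1) (W p.2)
  have hsingle : ∀ (p : ι × κ) (φ : Module.End K (V p.1 ⊗[K] W p.2)),
      ∃ a, Ψ a = Pi.single p φ := by
    intro p φ
    obtain ⟨t, rfl⟩ := (homTensorHomEquiv K (V p.1) (W p.2) (V p.1) (W p.2)).surjective φ
    induction t using TensorProduct.induction_on with
    | zero => exact ⟨0, by rw [map_zero, map_zero, Pi.single_zero]⟩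
    | add s t hs ht =>
      obtain ⟨a, ha⟩ := hs
      obtain ⟨b, hb⟩ := ht
      exact ⟨a + b, by rw [map_add, map_add, ha, hb, Pi.single_add]⟩
    | tmul f f' =>
      obtain ⟨a, ha, ha'⟩ := hV.exists_single p.1 f
      obtain ⟨b, hb, hb'⟩ := hW.exists_single p.2 f'
      refine ⟨a ⊗ₜ b, funext fun q => TensorProduct.ext' fun m n => ?_⟩
      refine (tensorRep_tmul (V q.1) (W q.2) a b m n).trans ?_
      rcases eq_or_ne q p with rfl | hq
      · rw [Pi.single_eq_same, ha, hb, homTensorHomEquiv_apply, TensorProduct.homTensorHomMap_apply,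
          TensorProduct.map_tmul]
      · rw [Pi.single_eq_of_ne hq, LinearMap.zero_apply]
        rcases eq_or_ne q.1 p.1 with h | h
        · rw [hb' q.2 fun h' => hq (Prod.ext h h'), TensorProduct.tmul_zero]
        · rw [ha' q.1 h, TensorProduct.zero_tmul]
  have hsurj : Function.Surjective Ψ := by
    intro φ
    choose a ha using fun p => hsingle p (φ p)
    exact ⟨∑ p, a p, by rw [map_sum]; simp only [ha]; exact Finset.univ_sum_single φ⟩
  have eA := hV.linearEquiv
  have eB := hW.linearEquiv
  have fA := Module.Finite.equiv eA.symm
  have fB := Module.Finite.equiv eB.symm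
  -- Both sides have dimension `∑ (dim V_i)² (dim W_j)²`, so surjectivity suffices.
  have hinj : Function.Injective Ψ := by
    refine (LinearMap.injective_iff_surjective_of_finrank_eq_finrank (f := Ψ.toLinearMap) ?_).mpr
      hsurj
    rw [Module.finrank_tensorProduct, eA.finrank_eq, eB.finrank_eq]
    simp only [Module.finrank_pi_fintype, Module.finrank_linearMap, Module.finrank_tensorProduct,
      Finset.sum_mul_sum, Fintype.sum_prod_type]
    exact Finset.sum_congr rfl fun i _ => Finset.sum_congr rfl fun j _ => mul_mul_mul_comm _ _ _ _
  refine isComplete_repMod _ (fun a ha => ?_) fun φ => ?_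
  · exact hinj (Eq.trans (funext ha : Ψ a = 0) (map_zero Ψ).symm)
  · obtain ⟨a, ha⟩ := hsurj φ
    exact ⟨a, fun p => congrFun ha p⟩

lemma IsObstruction.tensor {M : ModuleCat.{u} A.carrier} {N : ModuleCat.{u} B.carrier}
    {H : Subgroup G} {θ η : Z2 H K} (h : IsObstruction M H θ) (k : IsObstruction N H η) :
    IsObstruction (repMod (tensorRep M N)) H (θ * η) := by
  obtain ⟨T, h1, h2⟩ := h.exists_linearEquiv
  obtain ⟨T', k1, k2⟩ := k.exists_linearEquiv
  refine isObstruction_repMod (ρ := tensorRep M N) (fun g => TensorProduct.congr (T g) (T' g))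
    (fun g => tensorRep_smul _ (T g) (T' g) (h1 g) (k1 g)) fun g h l => ?_
  induction l using TensorProduct.induction_on with
  | zero => simp
  | add l l' h h' => simp only [map_add, smul_add, h, h']
  | tmul m n =>
    simp only [TensorProduct.congr_tmul, h2, k2, TensorProduct.smul_tmul_smul]
    rfl

lemma IsSemisimpleSplit.tensor (hA : A.IsSemisimpleSplit) (hB : B.IsSemisimpleSplit) :
    (A.tensor B).IsSemisimpleSplit :=
  have := hA.finite_irr
  have := hB.finite_irr
  isSemisimpleSplit_of_isComplete (isComplete_tensor hA.isComplete_out hB.isComplete_out)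

lemma tensor_isomorphic_irr (hA : A.IsSemisimpleSplit) (hB : B.IsSemisimpleSplit) :
    DecSet.Isomorphic (A.Irr.prod B.Irr) (A.tensor B).Irr := by
  have := hA.finite_irr
  have := hB.finite_irr
  have hc := isComplete_tensor hA.isComplete_out hB.isComplete_out
  refine isomorphic_irr (X := A.Irr.prod B.Irr)
    (fun x : A.IrrSet × B.IrrSet => completeFamily hc x)
    (bijective_cls_of_isComplete hc) ?_ ?_
  · rintro g ⟨x, y⟩
    obtain ⟨S, hS⟩ := exists_isSemilinear_out g (x : A.IrrSet)
    obtain ⟨S', hS'⟩ := exists_isSemilinear_out g (y : B.IrrSet)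
    obtain ⟨S, hS⟩ := IsSemilinear.exists_linearEquiv hS
    obtain ⟨S', hS'⟩ := IsSemilinear.exists_linearEquiv hS'
    exact isSemilinear_repMod
      (ρ := tensorRep (irrRep x).mod (irrRep y).mod)
      (ρ' := tensorRep (irrRep (g • x)).mod
        (irrRep (g • y)).mod)
      (TensorProduct.congr S S') (tensorRep_smul g S S' hS hS')
  · rintro ⟨x, y⟩
    obtain ⟨θ, h, hθ⟩ := exists_isObstruction_out (x : A.IrrSet)
    obtain ⟨η, k, hη⟩ := exists_isObstruction_out (y : B.IrrSet)
    have h' := h.restrict (conj_one (stab_fst (x, y)))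
    have k' := k.restrict (conj_one (stab_snd (x, y)))
    exact ⟨_, h'.tensor k', congrArg₂ (· * ·)
      (congrArg (muConj K 1 (stab G (x, y)) (stab G x) (conj_one (stab_fst (x, y)))) hθ)
      (congrArg (muConj K 1 (stab G (x, y)) (stab G y) (conj_one (stab_snd (x, y)))) hη)⟩

end tensor

end GAlgebra

namespace GAlgebra

variable {K : Type u} [Field K] {G : Type v} [Group G] {A B : GAlgebra.{u, v} K G}

/-! ### `G`-equivalences preserve `Irr` -/

noncomputable section

namespace GEquivalence

/-- A semilinear bijection `M → N`, as a linear equivalence `M ≃ N^[g]`. -/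
def linearEquivOfSemilinear {g : G} {M N : ModuleCat.{u} A.carrier} (S : M ≃+ N)
    (hS : IsSemilinear (A := A) g S) : M ≃ₗ[A.carrier] (A.twist g).obj N :=
  { toFun := fun m => S m
    map_add' := fun x y => S.map_add x y
    map_smul' := fun a m => hS a m
    invFun := fun m => S.symm m
    left_inv := fun m => S.symm_apply_apply m
    right_inv := fun m => S.apply_symm_apply m }

/-- A semilinear bijection `M → N`, as an isomorphism `M ≅ N^[g]`. -/
def isoTwist {g : G} {M N : ModuleCat.{u} A.carrier} (S : M ≃+ N)
    (hS : IsSemilinear (A := A) g S) : M ≅ (A.twist g).obj N :=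
  (linearEquivOfSemilinear S hS).toModuleIso

/-- An isomorphism `M ≅ N^[g]`, as a semilinear map. -/
def ofIsoTwist {g : G} {M N : ModuleCat.{u} A.carrier} (e : M ≅ (A.twist g).obj N) : M ≃+ N :=
  e.toLinearEquiv.toAddEquiv

lemma isSemilinear_ofIsoTwist {g : G} {M N : ModuleCat.{u} A.carrier}
    (e : M ≅ (A.twist g).obj N) : IsSemilinear (A := A) g (ofIsoTwist e) :=
  fun a m => e.toLinearEquiv.map_smul a m

variable (E : GEquivalence A B)

/-- The semilinear map `Φ M → Φ N` obtained from a semilinear map `M → N`. -/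
def mapSemilinear {g : G} {M N : ModuleCat.{u} A.carrier} (S : M ≃+ N)
    (hS : IsSemilinear (A := A) g S) : E.Φ.obj M ≃+ E.Φ.obj N :=
  ofIsoTwist (E.Φ.mapIso (isoTwist S hS) ≪≫ (E.β g).app N)

lemma isSemilinear_mapSemilinear {g : G} {M N : ModuleCat.{u} A.carrier} (S : M ≃+ N)
    (hS : IsSemilinear (A := A) g S) : IsSemilinear (A := B) g (E.mapSemilinear S hS) :=
  isSemilinear_ofIsoTwist _

/-- The relation `S T = c U` is an equality of morphisms `M → (M^[g])^[h]`. Naturality of `β h` and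
the pentagon axiom transport it through `Φ`, and `K`-linearity of `Φ` preserves `c`; hence `Φ` keeps
obstruction cocycles on the nose. -/
lemma mapSemilinear_mul {g h : G} {M : ModuleCat.{u} A.carrier} {S T U : M ≃+ M}
    (hS : IsSemilinear (A := A) g S) (hT : IsSemilinear (A := A) h T)
    (hU : IsSemilinear (A := A) (g * h) U) (c : K)
    (hc : ∀ m : M, S (T m) = algebraMap K A.carrier c • U m) (m : E.Φ.obj M) :
    E.mapSemilinear S hS (E.mapSemilinear T hT m) =
      algebraMap K B.carrier c • E.mapSemilinear U hU m := by
  have := E.additive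
  have := E.linear
  have h1 : (isoTwist T hT).hom ≫ (A.twist h).map (isoTwist S hS).hom =
      (c • (isoTwist U hU).hom) ≫ (A.twistMul g h).hom.app M := by
    ext m
    exact (hc m).trans (congrArg (· • U m) (smul_algebraMap' (g * h) c).symm)
  have h2 : (E.Φ.map (isoTwist T hT).hom ≫ (E.β h).hom.app M) ≫
      (B.twist h).map (E.Φ.map (isoTwist S hS).hom ≫ (E.β g).hom.app M) =
      (c • (E.Φ.map (isoTwist U hU).hom ≫ (E.β (g * h)).hom.app M)) ≫
        (B.twistMul g h).hom.app (E.Φ.obj M) := by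
    rw [Functor.map_comp, Category.assoc]
    have h3 := (E.β h).hom.naturality (isoTwist S hS).hom
    simp only [Functor.comp_map] at h3
    rw [← reassoc_of% h3, ← E.Φ.map_comp_assoc, h1]
    rw [E.Φ.map_comp, Category.assoc, E.pentagon, E.Φ.map_smul]
    simp
  have h4 := ConcreteCategory.congr_hom h2 m
  refine h4.trans ?_
  exact congrArg (fun b : B.carrier => b • E.mapSemilinear U hU m) (smul_algebraMap' (g * h) c)

lemma obstruction {M : ModuleCat.{u} A.carrier} {H : Subgroup G} {θ : Z2 H K}
    (h : IsObstruction M H θ) : IsObstruction (E.Φ.obj M) H θ := by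
  obtain ⟨T, h1, h2⟩ := h
  refine ⟨fun g => E.mapSemilinear (T g) (h1 g), fun g => E.isSemilinear_mapSemilinear _ (h1 g),
    fun g h m => ?_⟩
  exact E.mapSemilinear_mul (h1 g) (h1 h) (h1 (g * h)) _ (h2 g h) m

/-- The image of a simple module. -/
def mapAbsSimple (hB : B.IsSemisimpleSplit) (M : A.AbsSimple) : B.AbsSimple :=
  ⟨E.Φ.obj M.mod, hB.split _ (by
    have := E.isEquivalence
    have := E.additive
    have h1 : Simple M.mod := (simple_iff_isSimpleModule' M.mod).mpr M.2.simple
    exact (simple_iff_isSimpleModule' _).mp (simple_obj E.Φ M.mod))⟩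

lemma isomorphic_irr (E : GEquivalence A B) (hA : A.IsSemisimpleSplit) (hB : B.IsSemisimpleSplit) :
    DecSet.Isomorphic A.Irr B.Irr := by
  have := E.isEquivalence
  have := E.additive
  refine GAlgebra.isomorphic_irr (X := A.Irr) (fun x : A.IrrSet => E.mapAbsSimple hB (irrRep x))
    ⟨fun (x y : A.IrrSet) hxy => ?_, fun y => ?_⟩ (fun g (x : A.IrrSet) => ?_)
    fun x : A.IrrSet => ?_
  · obtain ⟨e⟩ := AbsSimple.cls_eq_iff.mp hxy
    refine (cls_irrRep x).symm.trans (Eq.trans ?_ (cls_irrRep y))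
    rw [AbsSimple.cls_eq_iff]
    have e' : E.Φ.obj (irrRep x).mod ≅ E.Φ.obj (irrRep y).mod := e.toModuleIso
    exact ⟨(E.Φ.preimageIso e').toLinearEquiv⟩
  · have i := E.Φ.objObjPreimageIso (irrRep y).mod
    have h1 : Simple (E.Φ.objPreimage (irrRep y).mod) := by
      have h2 : Simple (irrRep y).mod := (simple_iff_isSimpleModule' _).mpr (irrRep y).2.simple
      exact (simple_obj_iff E.Φ _).mp (Simple.of_iso i)
    let M : A.AbsSimple := ⟨E.Φ.objPreimage (irrRep y).mod,
      hA.split _ ((simple_iff_isSimpleModule' _).mp h1)⟩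
    refine ⟨M.cls, ?_⟩
    rw [← cls_irrRep y]
    have h3 : (irrRep M.cls).cls = M.cls := cls_irrRep _
    obtain ⟨e⟩ := AbsSimple.cls_eq_iff.mp h3
    exact AbsSimple.cls_eq_iff.mpr ⟨((E.Φ.mapIso e.toModuleIso) ≪≫ i).toLinearEquiv⟩
  · obtain ⟨S, hS⟩ := exists_isSemilinear_out g x
    exact ⟨E.mapSemilinear S hS, E.isSemilinear_mapSemilinear S hS⟩
  · obtain ⟨θ, h, hθ⟩ := exists_isObstruction_out x
    exact ⟨θ, E.obstruction h, hθ⟩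

end GEquivalence

end

end GAlgebra

/-! ### Twisted cocycles and their restrictions to stabilisers -/

section cocycle

variable {K : Type u} [Field K] {G : Type v} [Group G] {ι : Type*} [MulAction G ι]

/-- A `2`-cocycle of `G` with values in the `G`-module of functions `ι → Kˣ`. -/
def IsTwistedCocycle (α : G → G → ι → Kˣ) : Prop :=
  ∀ g h k x, α g h x * α (g * h) k x = α h k (g⁻¹ • x) * α g (h * k) x

/-- The restriction of a twisted cocycle to the stabiliser of a point. -/
def IsTwistedCocycle.restrict {α : G → G → ι → Kˣ} (hα : IsTwistedCocycle α) (x : ι) :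
    Z2 (MulAction.stabilizer G x) K :=
  ⟨fun p => α p.1 p.2 x, fun a b c => by
    have h1 := hα a b c x
    rw [MulAction.mem_stabilizer_iff.mp (inv_mem a.2)] at h1
    rw [mul_comm]
    exact h1⟩

/-- `r x` is a base point of the orbit of `x` and `t x` moves it to `x`. Then `(t x)⁻¹ g t(g⁻¹ x)`
fixes `r x`, which is how elements of `G` are compared with the stabiliser of the base point. -/
lemma exists_transversal (G : Type v) [Group G] (ι : Type*) [MulAction G ι] :
    ∃ (r : ι → ι) (t : ι → G), (∀ x, t x • r x = x) ∧ ∀ (g : G) x, r (g • x) = r x := by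
  have h1 : ∀ x : ι, ∃ g : G,
      g • Quotient.out (Quotient.mk (MulAction.orbitRel G ι) x) = x := fun x =>
    (MulAction.orbitRel G ι).symm (Quotient.mk_out (s := MulAction.orbitRel G ι) x)
  choose t ht using h1
  refine ⟨fun x => Quotient.out (Quotient.mk (MulAction.orbitRel G ι) x), t, ht, fun g x => ?_⟩
  exact congrArg Quotient.out (Quotient.sound ⟨g, rfl⟩)

/-- Injectivity of restriction to stabilisers on the second cohomology. -/
lemma IsTwistedCocycle.exists_cochain {δ : G → G → ι → Kˣ} (hδ : IsTwistedCocycle δ)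
    (hu : ∀ x, ∃ u : G → Kˣ, ∀ a b : G, a • x = x → b • x = x →
      δ a b x * u (a * b) = u a * u b) :
    ∃ c : G → ι → Kˣ, ∀ g h x, δ g h x * c (g * h) x = c g x * c h (g⁻¹ • x) := by
  obtain ⟨r, t, ht, hr⟩ := exists_transversal G ι
  choose u hu using hu
  have ht' : ∀ x, (t x)⁻¹ • x = r x := fun x => inv_smul_eq_iff.mpr (ht x).symm
  have hst : ∀ (g : G) x, ((t x)⁻¹ * g * t (g⁻¹ • x)) • r x = r x := by
    intro g x
    rw [mul_smul, mul_smul, ← hr g⁻¹ x, ht, smul_inv_smul, ht', hr]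
  -- With `y = g⁻¹ x`, `a = (t x)⁻¹ g t(y)` and symbols multiplying by `e_g e_h = δ(g,h) e_{gh}`,
  -- the equality `g t(y) = t(x) a` gives `e_g e_{t(y)} = δ(g, t y) δ(t x, a)⁻¹ e_{t(x)} e_a`. The
  -- cochain is this coefficient with `e_a` replaced by `u(a)`.
  refine ⟨fun g x => δ g (t (g⁻¹ • x)) x * u (r x) ((t x)⁻¹ * g * t (g⁻¹ • x)) *
    (δ (t x) ((t x)⁻¹ * g * t (g⁻¹ • x)) x)⁻¹, fun g h x => ?_⟩
  have hz : h⁻¹ • g⁻¹ • x = (g * h)⁻¹ • x := by rw [mul_inv_rev, mul_smul]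
  have hb := hst h (g⁻¹ • x)
  have ha := hst g x
  simp only [hz, hr] at hb ⊢
  generalize hy : g⁻¹ • x = y at *
  generalize (g * h)⁻¹ • x = z at *
  generalize hae : (t x)⁻¹ * g * t y = a at *
  generalize hbe : (t y)⁻¹ * h * t z = b at *
  have e1 : (t x)⁻¹ * (g * h) * t z = a * b := by rw [← hae, ← hbe]; group
  have e2 : t y * b = h * t z := by rw [← hbe]; group
  have e3 : t x * a = g * t y := by rw [← hae]; group
  rw [e1]
  have c1 := hδ g h (t z) x
  have c2 := hδ g (t y) b x
  have c3 := hδ (t x) a b x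
  have c4 := hu (r x) a b ha hb
  rw [hy] at c1 c2
  rw [e2] at c2
  rw [e3, ht'] at c3
  generalize δ g h x = d1 at *
  generalize δ (g * h) (t z) x = d2 at *
  generalize δ h (t z) y = d3 at *
  generalize δ g (h * t z) x = d4 at *
  generalize δ g (t y) x = d5 at *
  generalize δ (g * t y) b x = d6 at *
  generalize δ (t y) b y = d7 at *
  generalize δ (t x) a x = d8 at *
  generalize δ a b (r x) = d9 at *
  generalize δ (t x) (a * b) x = d10 at *
  generalize u (r x) (a * b) = u1 at *
  generalize u (r x) a = u2 at *
  generalize u (r x) b = u3 at *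
  -- The factors `d6` and `d9` occur in the cocycle relations `c2`, `c3`, `c4` but not in the goal;
  -- they are carried along and cancelled afterwards.
  have key : d1 * d2 * u1 * (d8 * d7) * d6 * d9 = d5 * u2 * d3 * u3 * d10 * d6 * d9 := by
    calc d1 * d2 * u1 * (d8 * d7) * d6 * d9 = (d1 * d2) * (d8 * d6) * (d9 * u1) * d7 := by
          ac_rfl
      _ = (d3 * d4) * (d9 * d10) * (u2 * u3) * d7 := by rw [c1, c3, c4]
      _ = (d7 * d4) * (d3 * d9 * d10 * u2 * u3) := by ac_rfl
      _ = (d5 * d6) * (d3 * d9 * d10 * u2 * u3) := by rw [c2]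
      _ = _ := by ac_rfl
  have key2 := mul_right_cancel (mul_right_cancel key)
  have e : d1 * (d2 * u1 * d10⁻¹) = (d1 * d2 * u1 * (d8 * d7)) * (d10⁻¹ * d8⁻¹ * d7⁻¹) := by
    rw [show (d1 * d2 * u1 * (d8 * d7)) * (d10⁻¹ * d8⁻¹ * d7⁻¹) =
      d1 * (d2 * u1 * d10⁻¹) * (d8 * d8⁻¹) * (d7 * d7⁻¹) by ac_rfl]
    simp
  rw [e, key2, show (d5 * u2 * d3 * u3 * d10) * (d10⁻¹ * d8⁻¹ * d7⁻¹) =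
      d5 * u2 * d8⁻¹ * (d3 * u3 * d7⁻¹) * (d10 * d10⁻¹) by ac_rfl]
  simp

/-- Equivariance of frills at the level of cocycles. The function `η` on all of `G` stands in for
`θ`, so that conjugates can be written without membership proofs. -/
lemma DecSet.frill_eq_of_conj (X : DecSet.{u, v, w} K G) {x y : X.carrier} (g : G)
    (hx : g • y = x) {θ : Z2 (stab G y) K} (hθ : X.frill y = QuotientGroup.mk θ)
    (η : G → G → Kˣ) (hη : ∀ a b : stab G y, θ.1 (a, b) = η a b)
    (ζ : Z2 (stab G x) K) (hζ : ∀ a b : stab G x, ζ.1 (a, b) = η (g⁻¹ * a * g) (g⁻¹ * b * g)) :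
    X.frill x = QuotientGroup.mk ζ := by
  subst hx
  rw [X.equivariant, hθ]
  refine congrArg (QuotientGroup.mk : Z2 _ K → Mu _ K) (Subtype.ext (funext fun p => ?_))
  refine (hη _ _).trans (Eq.trans ?_ (hζ p.1 p.2).symm)
  simp [conjHom]

/-- Surjectivity of restriction to stabilisers on the second cohomology: every family of frills
comes from a twisted cocycle. -/
lemma DecSet.exists_twistedCocycle (X : DecSet.{u, v, w} K G) :
    ∃ (α : G → G → X.carrier → Kˣ) (hα : IsTwistedCocycle α),
      ∀ x, X.frill x = QuotientGroup.mk (hα.restrict x) := by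
  classical
  obtain ⟨r, t, ht, hr⟩ := exists_transversal G X.carrier
  choose θ hθ using fun x => QuotientGroup.mk_surjective (X.frill x)
  -- The value 1 off the stabiliser is never used: all arguments below lie in the stabiliser.
  let η : X.carrier → G → G → Kˣ := fun x a b =>
    if h : a ∈ stab G x ∧ b ∈ stab G x then (θ x : Z2 (stab G x) K).1 (⟨a, h.1⟩, ⟨b, h.2⟩) else 1
  have hη : ∀ x (a b : stab G x), (θ x : Z2 (stab G x) K).1 (a, b) = η x a b := by
    intro x a b
    simp only [η]
    rw [dif_pos ⟨a.2, b.2⟩]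
  have hcoc : ∀ x a b c, a ∈ stab G x → b ∈ stab G x → c ∈ stab G x →
      η x a b * η x (a * b) c = η x b c * η x a (b * c) := by
    intro x a b c ha hb hc
    have h1 := (θ x).2 ⟨a, ha⟩ ⟨b, hb⟩ ⟨c, hc⟩
    rw [mul_comm] at h1
    simpa only [hη, Subgroup.coe_mul] using h1
  have ht' : ∀ x, (t x)⁻¹ • x = r x := fun x => inv_smul_eq_iff.mpr (ht x).symm
  have hst : ∀ (g : G) x, ((t x)⁻¹ * g * t (g⁻¹ • x)) ∈ stab G (r x) := by
    intro g x
    rw [MulAction.mem_stabilizer_iff, mul_smul, mul_smul, ← hr g⁻¹ x, ht, smul_inv_smul, ht', hr]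
  -- Shapiro's formula: the cocycle at the base point is evaluated on the comparison elements of `g`
  -- and `h`. For `g`, `h` fixing `x` these are the conjugates by `t x`, so the restriction is the
  -- transported frill.
  refine ⟨fun g h x => η (r x) ((t x)⁻¹ * g * t (g⁻¹ • x))
    ((t (g⁻¹ • x))⁻¹ * h * t (h⁻¹ • g⁻¹ • x)), fun g h k x => ?_, fun x => ?_⟩
  · have h1 := hst g x
    have h2 := hst h (g⁻¹ • x)
    have h3 := hst k (h⁻¹ • g⁻¹ • x)
    have hz : (g * h)⁻¹ • x = h⁻¹ • g⁻¹ • x := by rw [mul_inv_rev, mul_smul]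
    have hz' : (h * k)⁻¹ • g⁻¹ • x = k⁻¹ • h⁻¹ • g⁻¹ • x := by rw [mul_inv_rev, mul_smul]
    simp only [hr, hz, hz'] at h1 h2 h3 ⊢
    have h4 := hcoc (r x) _ _ _ h1 h2 h3
    convert h4 using 3 <;> group
  · refine X.frill_eq_of_conj (t x) (ht x) (hθ (r x)).symm (η (r x)) (hη (r x)) _ fun a b => ?_
    have ha : (a : G)⁻¹ • x = x := MulAction.mem_stabilizer_iff.mp (inv_mem a.2)
    have hb : (b : G)⁻¹ • x = x := MulAction.mem_stabilizer_iff.mp (inv_mem b.2)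
    simp only [IsTwistedCocycle.restrict, ha, hb]

end cocycle

/-! ### Realisation of decorated sets -/

section realisation

variable {K : Type u} [Field K] {G : Type v} [Group G]

/-- For each `x`, `G` acts on functions on `G` by translation twisted by `α(g, g⁻¹k)(x)`; the
cocycle identity says that composition has defect `α`. Finiteness of `G` makes the space
finite-dimensional. -/
lemma exists_twistedRegular [Finite G] {ι : Type*} [MulAction G ι] {α : G → G → ι → Kˣ}
    (hα : IsTwistedCocycle α) :
    ∃ (m : ℕ) (_ : NeZero m) (S : G → ι → ((Fin m → K) ≃ₗ[K] (Fin m → K))),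
      ∀ g h x l, S g x (S h (g⁻¹ • x) l) = (α g h x : K) • S (g * h) x l := by
  let S₀ : G → ι → ((G → K) ≃ₗ[K] (G → K)) := fun g x =>
    { toFun := fun φ k => (α g (g⁻¹ * k) x : K) * φ (g⁻¹ * k)
      invFun := fun φ k => ((α g k x)⁻¹ : Kˣ) * φ (g * k)
      map_add' := fun φ ψ => funext fun k => mul_add _ _ _
      map_smul' := fun c φ => funext fun k => mul_left_comm _ _ _
      left_inv := fun φ => funext fun k => by simp
      right_inv := fun φ => funext fun k => by simp }
  have hS₀ : ∀ g h x l, S₀ g x (S₀ h (g⁻¹ • x) l) = (α g h x : K) • S₀ (g * h) x l := by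
    intro g h x l
    funext k
    change (α g (g⁻¹ * k) x : K) * ((α h (h⁻¹ * (g⁻¹ * k)) (g⁻¹ • x) : K) *
      l (h⁻¹ * (g⁻¹ * k))) = (α g h x : K) * ((α (g * h) ((g * h)⁻¹ * k) x : K) *
        l ((g * h)⁻¹ * k))
    have e : (g * h)⁻¹ * k = h⁻¹ * (g⁻¹ * k) := by group
    rw [e]
    have h1 := congrArg Units.val (hα g h (h⁻¹ * (g⁻¹ * k)) x)
    rw [mul_inv_cancel_left] at h1
    simp only [Units.val_mul] at h1
    generalize h⁻¹ * (g⁻¹ * k) = k' at *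
    rw [← mul_assoc, ← mul_assoc, h1, mul_comm (α g (g⁻¹ * k) x : K)]
  -- Functions on `Fin m` rather than on `G` put the space in the universe of `K`.
  obtain ⟨m, ⟨e⟩⟩ := Finite.exists_equiv_fin G
  let E : (G → K) ≃ₗ[K] (Fin m → K) := LinearEquiv.funCongrLeft K K e.symm
  refine ⟨m, ⟨fun h => by subst h; exact (e 1).elim0⟩, fun g x => E.symm.trans ((S₀ g x).trans E),
    fun g h x l => ?_⟩
  simp only [LinearEquiv.trans_apply, LinearEquiv.symm_apply_apply, hS₀, map_smul]

variable {ι : Type} [MulAction G ι] {L : Type u} [AddCommGroup L] [Module K L]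

/-- The cocycle is not normalised, so `S 1 x` is the scalar `α(1,1)(x)` rather than the identity;
conjugation by it is still trivial. -/
lemma conj_projective_one {α : G → G → ι → Kˣ} {S : G → ι → (L ≃ₗ[K] L)}
    (hS : ∀ g h x l, S g x (S h (g⁻¹ • x) l) = (α g h x : K) • S (g * h) x l) (x : ι)
    (a : Module.End K L) : (S 1 x).conj a = a := by
  have h1 : ∀ l, S 1 x l = (α 1 1 x : K) • l := by
    intro l
    obtain ⟨l, rfl⟩ := (S 1 x).surjective l
    have h2 := hS 1 1 x l
    rwa [inv_one, one_smul, one_mul] at h2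
  refine LinearMap.ext fun l => ?_
  obtain ⟨l, rfl⟩ := (S 1 x).surjective l
  rw [LinearEquiv.conj_apply_apply, LinearEquiv.symm_apply_apply, h1, h1, map_smul]

lemma conj_projective_mul {α : G → G → ι → Kˣ} {S : G → ι → (L ≃ₗ[K] L)}
    (hS : ∀ g h x l, S g x (S h (g⁻¹ • x) l) = (α g h x : K) • S (g * h) x l) (g h : G) (x : ι)
    (a : Module.End K L) : (S (g * h) x).conj a = (S g x).conj ((S h (g⁻¹ • x)).conj a) := by
  refine LinearMap.ext fun l => ?_
  obtain ⟨l, rfl⟩ := (S g x).surjective l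
  obtain ⟨l, rfl⟩ := (S h (g⁻¹ • x)).surjective l
  have h1 : (S (g * h) x).symm (S g x (S h (g⁻¹ • x) l)) = (α g h x : K) • l := by
    rw [hS, map_smul, LinearEquiv.symm_apply_apply]
  rw [LinearEquiv.conj_apply_apply, LinearEquiv.conj_apply_apply, LinearEquiv.conj_apply_apply,
    LinearEquiv.symm_apply_apply, LinearEquiv.symm_apply_apply, h1, hS, map_smul, map_smul]

/-- The `G`-algebra `∏ i, End(L)` with the action given by projective transformations. -/
def conjAlgebra (α : G → G → ι → Kˣ) (S : G → ι → (L ≃ₗ[K] L))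
    (hS : ∀ g h x l, S g x (S h (g⁻¹ • x) l) = (α g h x : K) • S (g * h) x l) :
    GAlgebra.{u, v} K G :=
  letI act : MulSemiringAction G (ι → Module.End K L) :=
    { smul := fun g a i => (S g i).conj (a (g⁻¹ • i))
      one_smul := fun a => funext fun i => by
        change (S 1 i).conj (a ((1 : G)⁻¹ • i)) = a i
        rw [conj_projective_one hS, inv_one, one_smul]
      mul_smul := fun g h a => funext fun i => by
        change (S (g * h) i).conj (a ((g * h)⁻¹ • i)) =
          (S g i).conj ((S h (g⁻¹ • i)).conj (a (h⁻¹ • g⁻¹ • i)))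
        rw [conj_projective_mul hS, mul_inv_rev, mul_smul]
      smul_zero := fun g => funext fun i => map_zero (S g i).conj
      smul_add := fun g a b => funext fun i => map_add (S g i).conj _ _
      smul_one := fun g => funext fun i => (S g i).conj_id
      smul_mul := fun g a b => funext fun i => (S g i).conj_comp _ _ }
  { carrier := ι → Module.End K L
    action := act
    comm := ⟨fun g c a => funext fun i => map_smul (S g i).conj c (a (g⁻¹ • i))⟩ }

variable {α : G → G → ι → Kˣ}
  {S : G → ι → (L ≃ₗ[K] L)}

/-- The `i`-th simple representation of `conjAlgebra`. -/
def conjRep (hS : ∀ g h x l, S g x (S h (g⁻¹ • x) l) = (α g h x : K) • S (g * h) x l) (i : ι) :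
    (conjAlgebra α S hS).carrier →ₐ[K] Module.End K L :=
  Pi.evalAlgHom K (fun _ : ι => Module.End K L) i

lemma conjRep_smul (hS : ∀ g h x l, S g x (S h (g⁻¹ • x) l) = (α g h x : K) • S (g * h) x l)
    (g : G) (i j : ι) (hij : g • i = j) (a : (conjAlgebra α S hS).carrier) (l : L) :
    S g j (conjRep hS i a l) = conjRep hS j (g • a) (S g j l) := by
  subst hij
  change S g (g • i) ((show ι → Module.End K L from a) i l) =
    S g (g • i) ((show ι → Module.End K L from a) (g⁻¹ • g • i)
      ((S g (g • i)).symm (S g (g • i) l)))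
  rw [inv_smul_smul, LinearEquiv.symm_apply_apply]

lemma isComplete_conjAlgebra [Module.Finite K L] [Nontrivial L]
    (hS : ∀ g h x l, S g x (S h (g⁻¹ • x) l) = (α g h x : K) • S (g * h) x l) :
    IsComplete K (conjAlgebra α S hS).carrier (fun i => repMod (conjRep hS i)) :=
  isComplete_repMod _ (fun _ ha => funext ha) fun φ => ⟨φ, fun _ => rfl⟩

lemma DecSet.exists_isomorphic_irr [Finite G] (X : DecSet.{u, v, u + 1} K G)
    [Finite X.carrier] :
    ∃ A : GAlgebra.{u, v} K G, A.IsSemisimpleSplit ∧ DecSet.Isomorphic X A.Irr := by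
  obtain ⟨α, hα, hX⟩ := X.exists_twistedCocycle
  -- The carrier lies in a larger universe than `G`-algebras allow, so the factors are indexed by
  -- `Fin n` with the transported action.
  obtain ⟨n, ⟨e⟩⟩ := Finite.exists_equiv_fin X.carrier
  let _ : MulAction G (Fin n) := e.symm.mulAction G
  have he : ∀ (g : G) x, e (g • x) = g • e x := fun g x => by
    rw [Equiv.smul_def, Equiv.symm_symm, e.symm_apply_apply]
  have he' : ∀ (g : G) i, e.symm (g • i) = g • e.symm i := fun g i => by
    rw [e.symm_apply_eq, he, e.apply_symm_apply]
  obtain ⟨m, hm, S₀, hS₀⟩ := exists_twistedRegular hα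
  let S : G → Fin n → ((Fin m → K) ≃ₗ[K] (Fin m → K)) := fun g i => S₀ g (e.symm i)
  have hS : ∀ g h i l, S g i (S h (g⁻¹ • i) l) = (α g h (e.symm i) : K) • S (g * h) i l := by
    intro g h i l
    simp only [S, he', hS₀]
  let A := conjAlgebra (fun g h i => α g h (e.symm i)) S hS
  have hc : IsComplete K A.carrier (fun i => repMod (conjRep hS i)) := isComplete_conjAlgebra hS
  refine ⟨A, GAlgebra.isSemisimpleSplit_of_isComplete hc, GAlgebra.isomorphic_irr
    (fun x => GAlgebra.completeFamily hc (e x))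
    ((GAlgebra.bijective_cls_of_isComplete hc).comp e.bijective) (fun g x => ?_) fun x => ?_⟩
  · exact GAlgebra.isSemilinear_repMod (A := A) (ρ := conjRep hS (e x))
      (ρ' := conjRep hS (e (g • x))) (S g (e (g • x))) (conjRep_smul hS g _ _ (he g x).symm)
  · refine ⟨_, ?_, hX x⟩
    have hst : ∀ g : stab G x, (g : G) • e x = e x := fun g => by
      rw [← he, MulAction.mem_stabilizer_iff.mp g.2]
    refine GAlgebra.isObstruction_repMod (A := A) (ρ := conjRep hS (e x)) (fun g => S g (e x))
      (fun g => conjRep_smul hS g _ _ (hst g)) fun g h l => ?_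
    have h1 := hS g h (e x) l
    rw [inv_smul_eq_iff.mpr (hst g).symm, e.symm_apply_apply] at h1
    exact h1

end realisation

noncomputable section

/-! ### Morita contexts -/

/-- A surjective Morita context between the rings `R` and `T`, consisting of an `R`-`T`-bimodule
`Q`, a `T`-`R`-bimodule `P` and two pairings. -/
structure MoritaContext (R T : Type u) [Ring R] [Ring T] where
  Q : Type u
  P : Type u
  [addCommGroupQ : AddCommGroup Q]
  [addCommGroupP : AddCommGroup P]
  [moduleQ : Module R Q]
  [moduleP : Module T P]
  rightQ : Tᵐᵒᵖ →+* Module.End R Q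
  rightP : Rᵐᵒᵖ →+* Module.End T P
  pairR : P → Q →ₗ[R] R
  pairT : Q → P →ₗ[T] T
  pairT_add : ∀ q q' p, pairT (q + q') p = pairT q p + pairT q' p
  pairT_smul : ∀ (r : R) q p, pairT (r • q) p = pairT q (rightP (MulOpposite.op r) p)
  pairT_right : ∀ (t : T) q p, pairT (rightQ (MulOpposite.op t) q) p = pairT q p * t
  assocQ : ∀ q q' p, pairR p q' • q = rightQ (MulOpposite.op (pairT q p)) q'
  assocP : ∀ q p p', pairT q p' • p = rightP (MulOpposite.op (pairR p q)) p'
  n : ℕ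
  q : Fin n → Q
  p : Fin n → P
  sum_pairR : ∑ i, pairR (p i) (q i) = 1
  n' : ℕ
  q' : Fin n' → Q
  p' : Fin n' → P
  sum_pairT : ∑ i, pairT (q' i) (p' i) = 1

attribute [instance] MoritaContext.addCommGroupQ MoritaContext.addCommGroupP
  MoritaContext.moduleQ MoritaContext.moduleP

namespace MoritaContext

/-- The left `T`-module structure on `Hom_R(Q, M)` given by a right `T`-module structure on `Q`. -/
abbrev homModule {R T Q : Type u} [Ring R] [Ring T] [AddCommGroup Q] [Module R Q]
    (ρ : Tᵐᵒᵖ →+* Module.End R Q) (M : Type u) [AddCommGroup M] [Module R M] :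
    Module T (Q →ₗ[R] M) where
  smul t φ := φ ∘ₗ ρ (MulOpposite.op t)
  one_smul φ := by
    change φ ∘ₗ ρ (MulOpposite.op 1) = φ
    rw [MulOpposite.op_one, map_one]
    rfl
  mul_smul s t φ := by
    change φ ∘ₗ ρ (MulOpposite.op (s * t)) =
      (φ ∘ₗ ρ (MulOpposite.op t)) ∘ₗ ρ (MulOpposite.op s)
    rw [MulOpposite.op_mul, map_mul]
    rfl
  smul_zero t := LinearMap.zero_comp _
  smul_add t φ ψ := LinearMap.add_comp _ _ _
  add_smul s t φ := by
    change φ ∘ₗ ρ (MulOpposite.op (s + t)) =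
      φ ∘ₗ ρ (MulOpposite.op s) + φ ∘ₗ ρ (MulOpposite.op t)
    rw [MulOpposite.op_add, map_add, LinearMap.comp_add]
  zero_smul φ := by
    change φ ∘ₗ ρ (MulOpposite.op 0) = 0
    rw [MulOpposite.op_zero, map_zero, LinearMap.comp_zero]

/-- The functor `M ↦ Hom_R(Q, M)` from `R`-modules to `T`-modules, for an `R`-`T`-bimodule `Q`. -/
def homFunctor {R T Q : Type u} [Ring R] [Ring T] [AddCommGroup Q] [Module R Q]
    (ρ : Tᵐᵒᵖ →+* Module.End R Q) : ModuleCat.{u} R ⥤ ModuleCat.{u} T where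
  obj M := @ModuleCat.of T _ (Q →ₗ[R] M) _ (homModule ρ M)
  map {M N} f :=
    letI := homModule ρ M
    letI := homModule ρ N
    ModuleCat.ofHom
      { toFun := fun φ => f.hom ∘ₗ φ
        map_add' := fun _ _ => LinearMap.comp_add _ _ _
        map_smul' := fun _ _ => rfl }
  map_id _ := rfl
  map_comp _ _ := rfl

instance {R T Q : Type u} [Ring R] [Ring T] [AddCommGroup Q] [Module R Q]
    (ρ : Tᵐᵒᵖ →+* Module.End R Q) : (homFunctor ρ).Additive where
  map_add {M N f g} := by
    refine ModuleCat.hom_ext (LinearMap.ext fun φ => ?_)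
    exact LinearMap.add_comp (M := Q) φ g.hom f.hom

variable {R T : Type u} [Ring R] [Ring T] (C : MoritaContext R T)

/-- The homomorphism `Q → M` with `x ↦ ⟨x, p⟩ m`. -/
def toModule (p : C.P) {M : ModuleCat.{u} R} (m : M) : C.Q →ₗ[R] M :=
  LinearMap.toSpanSingleton R M m ∘ₗ C.pairR p

lemma toModule_apply (p : C.P) {M : ModuleCat.{u} R} (m : M) (x : C.Q) :
    C.toModule p m x = C.pairR p x • m := rfl

lemma sum_toModule {M : ModuleCat.{u} R} (m : M) : ∑ i, C.toModule (C.p i) m (C.q i) = m := by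
  simp only [toModule_apply, ← Finset.sum_smul, C.sum_pairR, one_smul]

/-- Associativity of the context turns a homomorphism through `φ x` into a `T`-multiple of `φ`. This
lets a `T`-linear map on `Hom_R(Q, M)` be evaluated on it. -/
lemma toModule_map {M : ModuleCat.{u} R} (p : C.P) (φ : C.Q →ₗ[R] M) (x : C.Q) :
    C.toModule p (φ x) = φ ∘ₗ C.rightQ (MulOpposite.op (C.pairT x p)) := by
  ext y
  rw [toModule_apply, ← map_smul, C.assocQ]
  rfl

lemma sum_right (x : C.Q) :
    ∑ i, C.rightQ (MulOpposite.op (C.pairT x (C.p i))) (C.q i) = x := by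
  simp only [← C.assocQ, ← Finset.sum_smul, C.sum_pairR, one_smul]

instance faithful_homFunctor : (homFunctor C.rightQ).Faithful where
  map_injective {M N f g} h := by
    ext m
    rw [← C.sum_toModule m, map_sum, map_sum]
    refine Finset.sum_congr rfl fun i _ => ?_
    have h1 := LinearMap.congr_fun (congrArg ModuleCat.Hom.hom h) (C.toModule (C.p i) m)
    exact LinearMap.congr_fun (f := f.hom ∘ₗ C.toModule (C.p i) m)
      (g := g.hom ∘ₗ C.toModule (C.p i) m) h1 (C.q i)

/-- Since `m = ∑ ⟨q_i, p_i⟩ m`, the preimage of `F` must be `m ↦ ∑ F(⟨-, p_i⟩ m)(q_i)`. The identity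
`f (φ x) = F φ x` gives both its linearity and the fact that it induces `F`. -/
instance full_homFunctor : (homFunctor C.rightQ).Full where
  map_surjective {M N} F := by
    let F' : (C.Q →ₗ[R] M) →+ (C.Q →ₗ[R] N) := F.hom.toAddMonoidHom
    have hF : ∀ (t : T) (φ : C.Q →ₗ[R] M),
        F' (φ ∘ₗ C.rightQ (MulOpposite.op t)) = F' φ ∘ₗ C.rightQ (MulOpposite.op t) :=
      fun t φ => F.hom.map_smul t φ
    let f : M →+ N :=
      { toFun := fun m => ∑ i, F' (C.toModule (C.p i) m) (C.q i)
        map_zero' := by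
          have h0 : ∀ p, C.toModule p (0 : M) = 0 := fun p => by ext; simp [toModule_apply]
          simp [h0]
        map_add' := fun m m' => by
          have h0 : ∀ p, C.toModule p (m + m') = C.toModule p m + C.toModule p m' := fun p => by
            ext; simp [toModule_apply]
          simp [h0, Finset.sum_add_distrib] }
    have hf : ∀ (φ : C.Q →ₗ[R] M) x, f (φ x) = F' φ x := by
      intro φ x
      change ∑ i, F' (C.toModule (C.p i) (φ x)) (C.q i) = _
      simp only [toModule_map, hF, LinearMap.comp_apply, ← map_sum, sum_right]
    refine ⟨ModuleCat.ofHom { f with map_smul' := fun r m => ?_ }, ?_⟩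
    · change f (r • m) = r • f m
      rw [← C.sum_toModule m, Finset.smul_sum, map_sum, map_sum, Finset.smul_sum]
      refine Finset.sum_congr rfl fun i _ => ?_
      rw [← map_smul, hf, hf, map_smul]
    · refine ModuleCat.hom_ext (LinearMap.ext fun φ => ?_)
      exact LinearMap.ext (f := (show C.Q →ₗ[R] N from _)) (g := F' φ) fun x => hf φ x

/-- The homomorphism `Q → Hom_T(P, N)` with `x ↦ (y ↦ ⟨x, y⟩ n)`. -/
def unitHom (N : ModuleCat.{u} T) (n : N) : C.Q →ₗ[R] (homFunctor C.rightP).obj N :=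
  letI := homModule C.rightP N
  ({ toFun := fun x => LinearMap.toSpanSingleton T N n ∘ₗ C.pairT x
     map_add' := fun x y => LinearMap.ext fun z => by simp [C.pairT_add, add_smul]
     map_smul' := fun r x => LinearMap.ext fun z => by
      simp only [LinearMap.comp_apply, C.pairT_smul]
      rfl } : C.Q →ₗ[R] (C.P →ₗ[T] N))

/-- An element of `Hom_R(Q, Hom_T(P, N))` as a function of two variables. -/
def eval₂ {N : ModuleCat.{u} T} (Θ : C.Q →ₗ[R] (homFunctor C.rightP).obj N) (x : C.Q) :
    C.P →ₗ[T] N := Θ x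

lemma eval₂_ext {N : ModuleCat.{u} T} {Θ Θ' : C.Q →ₗ[R] (homFunctor C.rightP).obj N}
    (h : ∀ x y, C.eval₂ Θ x y = C.eval₂ Θ' x y) : Θ = Θ' :=
  LinearMap.ext fun x => LinearMap.ext (f := C.eval₂ Θ x) (g := C.eval₂ Θ' x) (h x)

lemma eval₂_unitHom {N : ModuleCat.{u} T} (n : N) (x : C.Q) (y : C.P) :
    C.eval₂ (C.unitHom N n) x y = C.pairT x y • n := rfl

lemma eval₂_smul {N : ModuleCat.{u} T} (Θ : C.Q →ₗ[R] (homFunctor C.rightP).obj N) (r : R)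
    (x : C.Q) (y : C.P) :
    C.eval₂ Θ (r • x) y = C.eval₂ Θ x (C.rightP (MulOpposite.op r) y) :=
  LinearMap.congr_fun (f := C.eval₂ Θ (r • x)) (g := C.eval₂ Θ x ∘ₗ C.rightP (MulOpposite.op r))
    (Θ.map_smul r x) y

lemma eval₂_sum {N : ModuleCat.{u} T} (Θ : C.Q →ₗ[R] (homFunctor C.rightP).obj N) {κ : Type*}
    (s : Finset κ) (x : κ → C.Q) (y : C.P) :
    C.eval₂ Θ (∑ i ∈ s, x i) y = ∑ i ∈ s, C.eval₂ Θ (x i) y :=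
  (congrArg (fun φ : C.P →ₗ[T] N => φ y) (map_sum Θ x s)).trans
    (LinearMap.sum_apply s (fun i => C.eval₂ Θ (x i)) y)

/-- The unit `N → Hom_R(Q, Hom_T(P, N))`. -/
def unit (N : ModuleCat.{u} T) :
    N →ₗ[T] (homFunctor C.rightQ).obj ((homFunctor C.rightP).obj N) where
  toFun n := C.unitHom N n
  map_add' n n' := C.eval₂_ext fun x y => smul_add (C.pairT x y) n n'
  map_smul' t n := C.eval₂_ext fun x y => by
    refine Eq.trans ?_ (congrArg (· • n) (C.pairT_right t x y)).symm
    exact (mul_smul (C.pairT x y) t n).symm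

/-- The relation `∑ ⟨q'_i, p'_i⟩ = 1` recovers `n` as `∑ Θ(q'_i)(p'_i)`. The same sum gives a
preimage of any `Θ`, because the associativity rules move `⟨x, y⟩` inside. -/
lemma bijective_unit (N : ModuleCat.{u} T) : Function.Bijective (C.unit N) := by
  refine ⟨fun n n' h => ?_, fun Θ => ?_⟩
  · rw [← one_smul T n, ← one_smul T n', ← C.sum_pairT, Finset.sum_smul, Finset.sum_smul]
    refine Finset.sum_congr rfl fun i _ => ?_
    exact congrArg (fun Θ => C.eval₂ Θ (C.q' i) (C.p' i)) h
  · change C.Q →ₗ[R] (homFunctor C.rightP).obj N at Θ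
    refine ⟨∑ i, C.eval₂ Θ (C.q' i) (C.p' i), C.eval₂_ext fun x y => ?_⟩
    refine (C.eval₂_unitHom _ x y).trans ?_
    have h1 : ∀ i, C.pairT x y • C.eval₂ Θ (C.q' i) (C.p' i) =
        C.eval₂ Θ (C.rightQ (MulOpposite.op (C.pairT (C.q' i) (C.p' i))) x) y := by
      intro i
      rw [← map_smul, C.assocP, ← C.eval₂_smul, C.assocQ]
    rw [Finset.smul_sum]
    simp only [h1]
    rw [← C.eval₂_sum, ← LinearMap.sum_apply, ← map_sum, ← Finset.op_sum, C.sum_pairT,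
      MulOpposite.op_one, map_one]
    rfl

instance essSurj_homFunctor : (homFunctor C.rightQ).EssSurj where
  mem_essImage N := ⟨(homFunctor C.rightP).obj N,
    ⟨(LinearEquiv.ofBijective (C.unit N) (C.bijective_unit N)).toModuleIso.symm⟩⟩

instance isEquivalence_homFunctor : (homFunctor C.rightQ).IsEquivalence where

end MoritaContext

/-! ### Equivariant Morita contexts -/

section equivariant

variable {K : Type u} [Field K] {G : Type v} [Group G]

/-- A Morita context between `G`-algebras with an action of `G` on the bimodule `Q`. -/
structure GMoritaContext (A B : GAlgebra.{u, v} K G) extends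
    MoritaContext A.carrier B.carrier where
  γ : G → Q →+ Q
  γ_one : ∀ x, γ 1 x = x
  γ_mul : ∀ g h x, γ (g * h) x = γ g (γ h x)
  γ_smul : ∀ g (a : A.carrier) x, γ g (a • x) = (g • a) • γ g x
  γ_right : ∀ g (b : B.carrier) x,
    γ g (rightQ (MulOpposite.op b) x) = rightQ (MulOpposite.op (g • b)) (γ g x)
  right_algebraMap : ∀ (c : K) x,
    rightQ (MulOpposite.op (algebraMap K B.carrier c)) x = algebraMap K A.carrier c • x

namespace GMoritaContext

variable {A B : GAlgebra.{u, v} K G} (C : GMoritaContext A B)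

/-- The functor `Hom_A(Q, -)`. -/
abbrev functor : ModuleCat.{u} A.carrier ⥤ ModuleCat.{u} B.carrier :=
  MoritaContext.homFunctor C.rightQ

lemma γ_inv (g : G) (x : C.Q) : C.γ g (C.γ g⁻¹ x) = x := by
  rw [← C.γ_mul, mul_inv_cancel, C.γ_one]

lemma γ_inv' (g : G) (x : C.Q) : C.γ g⁻¹ (C.γ g x) = x := by
  rw [← C.γ_mul, inv_mul_cancel, C.γ_one]

/-- Precomposition with the action of `g⁻¹`. -/
def twistHom (g : G) {M : ModuleCat.{u} A.carrier} (φ : C.Q →ₗ[A.carrier] (A.twist g).obj M) :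
    C.Q →ₗ[A.carrier] M where
  toFun x := φ (C.γ g⁻¹ x)
  map_add' x y := (congrArg φ (map_add (C.γ g⁻¹) x y)).trans (map_add φ _ _)
  map_smul' a x := by
    refine (congrArg φ (C.γ_smul g⁻¹ a x)).trans ((φ.map_smul _ _).trans ?_)
    exact congrArg (fun a : A.carrier => a • (show M from φ (C.γ g⁻¹ x))) (smul_inv_smul g a)

/-- Precomposition with the action of `g`. -/
def untwistHom (g : G) {M : ModuleCat.{u} A.carrier} (φ : C.Q →ₗ[A.carrier] M) :
    C.Q →ₗ[A.carrier] (A.twist g).obj M where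
  toFun x := φ (C.γ g x)
  map_add' x y := (congrArg φ (map_add (C.γ g) x y)).trans (map_add φ _ _)
  map_smul' a x := (congrArg φ (C.γ_smul g a x)).trans (φ.map_smul _ _)

/-- The isomorphism `Hom_A(Q, M^[g]) ≅ Hom_A(Q, M)^[g]`. -/
def twistEquiv (g : G) (M : ModuleCat.{u} A.carrier) :
    C.functor.obj ((A.twist g).obj M) ≃ₗ[B.carrier] (B.twist g).obj (C.functor.obj M) where
  toFun φ := C.twistHom g φ
  invFun φ := C.untwistHom g (show C.Q →ₗ[A.carrier] M from φ)
  map_add' φ ψ := rfl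
  map_smul' b φ := by
    refine LinearMap.ext (f := C.twistHom g (b • φ))
      (g := C.twistHom g φ ∘ₗ C.rightQ (MulOpposite.op (g • b))) fun x => ?_
    refine congrArg (show C.Q →ₗ[A.carrier] (A.twist g).obj M from φ) (Eq.symm ?_)
    rw [C.γ_right, inv_smul_smul]
  left_inv φ := LinearMap.ext (f := C.untwistHom g (C.twistHom g φ))
    (g := (show C.Q →ₗ[A.carrier] (A.twist g).obj M from φ)) fun x =>
      congrArg (show C.Q →ₗ[A.carrier] (A.twist g).obj M from φ) (C.γ_inv' g x)
  right_inv φ := LinearMap.ext (f := C.twistHom g (C.untwistHom g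
      (show C.Q →ₗ[A.carrier] M from φ))) (g := (show C.Q →ₗ[A.carrier] M from φ)) fun x =>
      congrArg (show C.Q →ₗ[A.carrier] M from φ) (C.γ_inv g x)

/-- The `G`-equivalence given by an equivariant Morita context. -/
def gEquivalence : GAlgebra.GEquivalence A B where
  Φ := C.functor
  isEquivalence := C.toMoritaContext.isEquivalence_homFunctor
  additive := inferInstance
  linear :=
    { map_smul := fun {M N} f c => by
        refine ModuleCat.hom_ext (LinearMap.ext fun φ => ?_)
        refine LinearMap.ext (f := ((c • f).hom ∘ₗ (show C.Q →ₗ[A.carrier] M from φ)))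
          (g := (f.hom ∘ₗ (show C.Q →ₗ[A.carrier] M from φ)) ∘ₗ
            C.rightQ (MulOpposite.op (algebraMap K B.carrier c))) fun x => ?_
        refine Eq.trans ?_ (congrArg (f.hom ∘ₗ (show C.Q →ₗ[A.carrier] M from φ))
          (C.right_algebraMap c x)).symm
        exact (map_smul (f.hom ∘ₗ (show C.Q →ₗ[A.carrier] M from φ)) _ x).symm }
  β g := NatIso.ofComponents (fun M => (C.twistEquiv g M).toModuleIso) fun f => rfl
  pentagon g h M := by
    refine ModuleCat.hom_ext (LinearMap.ext fun φ => ?_)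
    change C.Q →ₗ[A.carrier] (A.twist (g * h)).obj M at φ
    refine LinearMap.ext (f := C.twistHom g (C.twistHom h
      (((A.twistMul g h).hom.app M).hom ∘ₗ φ))) (g := C.twistHom (g * h) φ) fun x => ?_
    -- Both sides precompose `φ` with the action of `(gh)⁻¹ = h⁻¹ g⁻¹`, so the pentagon is
    -- multiplicativity of `γ`.
    refine congrArg φ ?_
    rw [← C.γ_mul, mul_inv_rev]

end GMoritaContext

end equivariant

end

noncomputable section

namespace GAlgebra

/-! ### The projective action on a sum of simple modules -/

section projective

variable {K : Type u} [Field K] {G : Type v} [Group G] {A : GAlgebra.{u, v} K G}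
  {ι : Type*} [MulAction G ι]

lemma IsAbsSimple.exists_unit_of_semilinear {M N : ModuleCat.{u} A.carrier}
    (hN : A.IsAbsSimple N) {g : G} {S T : M ≃+ N} (hS : IsSemilinear (A := A) g S)
    (hT : IsSemilinear (A := A) g T) :
    ∃ c : Kˣ, ∀ m, S m = algebraMap K A.carrier (c : K) • T m := by
  obtain ⟨c, hc⟩ := hN.exists_unit (1 : G) (T.symm.trans S) (AddEquiv.refl N)
    (fun a n => by
      change S (T.symm (a • n)) = ((1 : G) • a) • S (T.symm n)
      rw [hT.symm, hS, smul_inv_smul, one_smul]) (fun a n => by simp)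
  refine ⟨c, fun m => ?_⟩
  have h1 := hc (T m)
  simpa using h1

/-- A projective action of `G` on the product of the modules `V i`: the lifts `S g`, semilinear
over `A` and permuting the factors, are multiplicative up to the cocycle `α`. -/
structure IsProjectiveAction (V : ι → A.AbsSimple) (α : G → G → ι → Kˣ)
    (S : G → ((∀ i, (V i).mod) ≃+ (∀ i, (V i).mod))) : Prop where
  smul : ∀ g (a : A.carrier) v, S g (a • v) = (g • a) • S g v
  smul_fun : ∀ g (z : ι → K) v, S g (z • v) = (fun i => z (g⁻¹ • i)) • S g v
  mul : ∀ g h v, S g (S h v) = (fun i => (α g h i : K)) • S (g * h) v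

lemma exists_permuting (V : ι → A.AbsSimple)
    (hV : ∀ (g : G) i, (V (g • i)).cls = g • (V i).cls) (g : G) :
    ∃ S : (∀ i, (V i).mod) ≃+ (∀ i, (V i).mod),
      (∀ (a : A.carrier) v, S (a • v) = (g • a) • S v) ∧
      (∀ (z : ι → K) v, S (z • v) = (fun i => z (g⁻¹ • i)) • S v) ∧
      ∀ i, ∃ T : (V i).mod ≃+ (V (g • i)).mod, IsSemilinear (A := A) g T ∧
        ∀ v, S v (g • i) = T (v i) := by
  choose s hs using fun i => smul_cls_eq_iff.mp (hV g i).symm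
  let E : (∀ i, (V i).mod) ≃ (∀ i, (V i).mod) :=
    Equiv.piCongr (W := fun i => (V i).mod) (Z := fun i => (V i).mod) (MulAction.toPerm g)
      (fun i => (s i).toEquiv)
  have hS : ∀ v i, E v (g • i) = s i (v i) := fun v i => Equiv.piCongr_apply_apply _ _ v i
  let S : (∀ i, (V i).mod) ≃+ (∀ i, (V i).mod) :=
    { E with
      map_add' := fun v w => funext fun j => by
        obtain ⟨i, rfl⟩ := MulAction.surjective g j
        refine (hS _ i).trans ((map_add (s i) _ _).trans ?_)
        exact (congrArg₂ (· + ·) (hS v i) (hS w i)).symm }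
  have hS' : ∀ v i, S v (g • i) = s i (v i) := hS
  refine ⟨S, fun a v => funext fun j => ?_, fun z v => funext fun j => ?_,
    fun i => ⟨s i, hs i, fun v => hS' v i⟩⟩
  · obtain ⟨i, rfl⟩ := MulAction.surjective g j
    rw [hS', Pi.smul_apply, Pi.smul_apply, hs, hS']
  · obtain ⟨i, rfl⟩ := MulAction.surjective g j
    rw [hS', Pi.smul_apply', Pi.smul_apply', hS', inv_smul_smul]
    exact (hs i _ _).trans (congrArg (· • s i (v i)) (smul_algebraMap' g (z i)))

/-- By Schur's lemma `S g ∘ S h` and `S (gh)` differ by one scalar on each factor; these scalars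
form `α`, a cocycle by associativity. For `g` fixing `i`, the component of `S g` at `i` is a lift on
`V i`, so the restriction of `α` is an obstruction cocycle. -/
lemma exists_projectiveAction (V : ι → A.AbsSimple)
    (hV : ∀ (g : G) i, (V (g • i)).cls = g • (V i).cls) :
    ∃ (α : G → G → ι → Kˣ) (hα : IsTwistedCocycle α)
      (S : G → ((∀ i, (V i).mod) ≃+ (∀ i, (V i).mod))),
      IsProjectiveAction V α S ∧
      ∀ i, IsObstruction (V i).mod (MulAction.stabilizer G i) (hα.restrict i) := by
  classical
  choose S h1 h2 h3 using exists_permuting V hV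
  have h4 : ∀ (g : G) i j, g • i = j → ∃ T : (V i).mod ≃+ (V j).mod,
      IsSemilinear (A := A) g T ∧ ∀ v, S g v j = T (v i) := by
    rintro g i _ rfl
    exact h3 g i
  have h5 : ∀ g h j, ∃ c : Kˣ, ∀ v, S g (S h v) j = (c : K) • S (g * h) v j := by
    intro g h j
    obtain ⟨T₁, a1, b1⟩ := h4 g (g⁻¹ • j) j (smul_inv_smul g j)
    obtain ⟨T₂, a2, b2⟩ := h4 h ((g * h)⁻¹ • j) (g⁻¹ • j) (by
      rw [mul_inv_rev, mul_smul, smul_inv_smul])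
    obtain ⟨T, a3, b3⟩ := h4 (g * h) ((g * h)⁻¹ • j) j (smul_inv_smul _ j)
    obtain ⟨c, hc⟩ := (V j).2.exists_unit_of_semilinear (g := g * h) (S := T₂.trans T₁) (T := T)
      (fun a m => by
        change T₁ (T₂ (a • m)) = ((g * h) • a) • T₁ (T₂ m)
        rw [a2, a1, mul_smul]) a3
    refine ⟨c, fun v => ?_⟩
    rw [b1, b2, b3]
    exact hc _
  choose α hα using h5
  have hmul : ∀ g h v, S g (S h v) = (fun i => (α g h i : K)) • S (g * h) v := fun g h v =>
    funext fun j => hα g h j v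
  have hcoc : IsTwistedCocycle α := by
    intro g h k x
    apply Units.ext
    have hN : A.IsAbsSimple (V x).mod := (V x).2
    refine IsAbsSimple.scalar_inj hN fun m => ?_
    obtain ⟨v, hv⟩ := (S (g * h * k)).surjective (Pi.single x m)
    have hm : S (g * h * k) v x = m := by rw [hv, Pi.single_eq_same]
    have e1 : S g (S h (S k v)) x = ((α g h x * α (g * h) k x : Kˣ) : K) • m := by
      rw [hα, hα, hm, smul_smul, Units.val_mul]
    have e2 : S g (S h (S k v)) x = ((α h k (g⁻¹ • x) * α g (h * k) x : Kˣ) : K) • m := by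
      rw [hmul h k, h2, Pi.smul_apply', hα, ← mul_assoc, hm, smul_smul, Units.val_mul]
    exact e1.symm.trans e2
  refine ⟨α, hcoc, S, ⟨h1, h2, hmul⟩, fun i => ?_⟩
  choose T hT hT' using fun g : MulAction.stabilizer G i => h4 (g : G) i i g.2
  refine ⟨T, hT, fun g h m => ?_⟩
  have e1 := hα g h i (Pi.single i m)
  rw [hT' g, hT' h, Pi.single_eq_same] at e1
  refine e1.trans (congrArg ((α g h i : K) • ·) ?_)
  exact (hT' (g * h) _).trans (by rw [Pi.single_eq_same])

/-- The quotient `α/β` is a coboundary on each stabiliser, hence is the twisted coboundary of a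
cochain `c` on `G`. Multiplying `S g` by `c g` factorwise changes the cocycle from `β` to `α`. -/
lemma IsProjectiveAction.rescale {V : ι → A.AbsSimple} {α β : G → G → ι → Kˣ}
    {S : G → ((∀ i, (V i).mod) ≃+ (∀ i, (V i).mod))} (h : IsProjectiveAction V β S)
    (hα : IsTwistedCocycle α) (hβ : IsTwistedCocycle β)
    (hαβ : ∀ i, (QuotientGroup.mk (hα.restrict i) : Mu (MulAction.stabilizer G i) K) =
      QuotientGroup.mk (hβ.restrict i)) :
    ∃ S', IsProjectiveAction V α S' := by
  classical
  let δ : G → G → ι → Kˣ := fun g h i => α g h i * (β g h i)⁻¹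
  have hδ : IsTwistedCocycle δ := by
    intro g h k x
    simp only [δ]
    rw [mul_mul_mul_comm, hα, ← mul_inv, hβ, mul_inv, mul_mul_mul_comm]
  obtain ⟨c, hc⟩ := hδ.exists_cochain fun i => by
    obtain ⟨u, hu⟩ := QuotientGroup.eq.mp (hαβ i).symm
    refine ⟨fun g => if hg : g ∈ MulAction.stabilizer G i then u ⟨g, hg⟩ else 1,
      fun a b ha hb => ?_⟩
    have ha' : a ∈ MulAction.stabilizer G i := ha
    have hb' : b ∈ MulAction.stabilizer G i := hb
    beta_reduce
    rw [dif_pos ha', dif_pos hb', dif_pos (mul_mem ha' hb')]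
    have h1 := congrFun (congrArg Subtype.val hu) (⟨a, ha'⟩, ⟨b, hb'⟩)
    change u ⟨a, ha'⟩ * u ⟨b, hb'⟩ * (u ⟨a * b, mul_mem ha' hb'⟩)⁻¹ =
      (β a b i)⁻¹ * α a b i at h1
    simp only [δ]
    rw [mul_comm (α a b i), ← h1, inv_mul_cancel_right]
  let m : G → ((∀ i, (V i).mod) ≃+ (∀ i, (V i).mod)) := fun g =>
    { toFun := fun v => (fun i => (c g i : K)) • v
      invFun := fun v => (fun i => ((c g i)⁻¹ : K)) • v
      map_add' := fun v w => smul_add _ v w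
      left_inv := fun v => funext fun i => inv_smul_smul₀ (c g i).ne_zero (v i)
      right_inv := fun v => funext fun i => smul_inv_smul₀ (c g i).ne_zero (v i) }
  have hm : ∀ g v, m g v = (fun i => (c g i : K)) • v := fun _ _ => rfl
  refine ⟨fun g => (S g).trans (m g), fun g a v => ?_, fun g z v => ?_, fun g k v => ?_⟩
  · simp only [AddEquiv.trans_apply, hm, h.smul]
    exact funext fun i => smul_comm (c g i : K) (g • a) (S g v i)
  · simp only [AddEquiv.trans_apply, hm, h.smul_fun]
    exact smul_comm _ _ _
  · simp only [AddEquiv.trans_apply, hm, h.smul_fun, h.mul, smul_smul]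
    congr 1
    funext i
    have h1 := congrArg Units.val (hc g k i)
    simp only [δ, Units.val_mul] at h1
    simp only [Pi.mul_apply]
    rw [← mul_assoc, ← h1, mul_right_comm, mul_assoc (α g k i : K), ← Units.val_mul,
      inv_mul_cancel, Units.val_one, mul_one]

end projective

/-! ### The equivariant Morita context of two algebras with isomorphic decorated sets -/

section context

/-- The Morita context between the endomorphism rings of two modules over a commutative ring. -/
@[reducible]
def endContext {R T Z V W : Type u} [Ring R] [Ring T] [CommRing Z] [AddCommGroup V] [Module Z V]
    [AddCommGroup W] [Module Z W] (eR : R ≃+* Module.End Z V) (eT : T ≃+* Module.End Z W)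
    {n n' : ℕ} (q : Fin n → (W →ₗ[Z] V)) (p : Fin n → (V →ₗ[Z] W))
    (h : ∑ i, q i ∘ₗ p i = LinearMap.id) (q' : Fin n' → (W →ₗ[Z] V))
    (p' : Fin n' → (V →ₗ[Z] W)) (h' : ∑ i, p' i ∘ₗ q' i = LinearMap.id) : MoritaContext R T :=
  letI mQ : Module R (W →ₗ[Z] V) := Module.compHom (W →ₗ[Z] V) eR.toRingHom
  letI mP : Module T (V →ₗ[Z] W) := Module.compHom (V →ₗ[Z] W) eT.toRingHom
  have hQ : ∀ (r : R) (x : W →ₗ[Z] V), r • x = eR r ∘ₗ x := fun _ _ => rfl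
  have hP : ∀ (t : T) (x : V →ₗ[Z] W), t • x = eT t ∘ₗ x := fun _ _ => rfl
  { Q := W →ₗ[Z] V
    P := V →ₗ[Z] W
    rightQ :=
      { toFun := fun t =>
          { toFun := fun x => x ∘ₗ eT t.unop
            map_add' := fun x y => LinearMap.add_comp _ _ _
            map_smul' := fun r x => rfl }
        map_one' := LinearMap.ext fun x => LinearMap.ext fun w => by simp
        map_mul' := fun s t => LinearMap.ext fun x => LinearMap.ext fun w => by simp
        map_zero' := LinearMap.ext fun x => LinearMap.ext fun w => by simp
        map_add' := fun s t => LinearMap.ext fun x => LinearMap.ext fun w => by simp }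
    rightP :=
      { toFun := fun t =>
          { toFun := fun x => x ∘ₗ eR t.unop
            map_add' := fun x y => LinearMap.add_comp _ _ _
            map_smul' := fun r x => rfl }
        map_one' := LinearMap.ext fun x => LinearMap.ext fun w => by simp
        map_mul' := fun s t => LinearMap.ext fun x => LinearMap.ext fun w => by simp
        map_zero' := LinearMap.ext fun x => LinearMap.ext fun w => by simp
        map_add' := fun s t => LinearMap.ext fun x => LinearMap.ext fun w => by simp }
    pairR := fun p =>
      { toFun := fun q => eR.symm (q ∘ₗ p)
        map_add' := fun x y => by rw [LinearMap.add_comp, map_add]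
        map_smul' := fun r x => by
          rw [hQ, LinearMap.comp_assoc]
          change eR.symm (eR r * (x ∘ₗ p)) = r * eR.symm (x ∘ₗ p)
          rw [map_mul, eR.symm_apply_apply] }
    pairT := fun q =>
      { toFun := fun p => eT.symm (p ∘ₗ q)
        map_add' := fun x y => by rw [LinearMap.add_comp, map_add]
        map_smul' := fun r x => by
          rw [hP, LinearMap.comp_assoc]
          change eT.symm (eT r * (x ∘ₗ q)) = r * eT.symm (x ∘ₗ q)
          rw [map_mul, eT.symm_apply_apply] }
    pairT_add := fun x y p => by
      change eT.symm (p ∘ₗ (x + y)) = eT.symm (p ∘ₗ x) + eT.symm (p ∘ₗ y)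
      rw [LinearMap.comp_add, map_add]
    pairT_smul := fun r x y => rfl
    pairT_right := fun t x y => by
      change eT.symm ((y ∘ₗ x) * eT t) = eT.symm (y ∘ₗ x) * t
      rw [map_mul, eT.symm_apply_apply]
    assocQ := fun x x' y => by
      change eR (eR.symm (x' ∘ₗ y)) ∘ₗ x = x' ∘ₗ eT (eT.symm (y ∘ₗ x))
      rw [eR.apply_symm_apply, eT.apply_symm_apply, LinearMap.comp_assoc]
    assocP := fun x y y' => by
      change eT (eT.symm (y' ∘ₗ x)) ∘ₗ y = y' ∘ₗ eR (eR.symm (x ∘ₗ y))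
      rw [eR.apply_symm_apply, eT.apply_symm_apply, LinearMap.comp_assoc]
    n := n
    q := q
    p := p
    sum_pairR := by
      change ∑ i, eR.symm (q i ∘ₗ p i) = 1
      rw [← map_sum, h]
      exact map_one eR.symm
    n' := n'
    q' := q'
    p' := p'
    sum_pairT := by
      change ∑ i, eT.symm (p' i ∘ₗ q' i) = 1
      rw [← map_sum, h']
      exact map_one eT.symm }

variable {K : Type u} [Field K] {ι : Type*}

/-- The map between products given by a linear map between factors with the same index. -/
def singleHom [DecidableEq ι] {V W : ι → Type*} [∀ i, AddCommGroup (V i)] [∀ i, Module K (V i)]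
    [∀ i, AddCommGroup (W i)] [∀ i, Module K (W i)] (i : ι) (f : W i →ₗ[K] V i) :
    (∀ i, W i) →ₗ[ι → K] (∀ i, V i) where
  toFun w := Pi.single i (f (w i))
  map_add' w w' := by rw [Pi.add_apply, map_add, Pi.single_add]
  map_smul' z w := funext fun j => by
    rw [RingHom.id_apply, Pi.smul_apply', Pi.smul_apply', map_smul]
    rcases eq_or_ne j i with rfl | h
    · rw [Pi.single_eq_same, Pi.single_eq_same]
    · rw [Pi.single_eq_of_ne h, Pi.single_eq_of_ne h, smul_zero]

/-- Each rank one operator of a basis expansion of `V i` factors through a line in `W i`, available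
since `W i ≠ 0`. Used in both directions, this makes both pairings of the Morita context surjective.
-/
lemma exists_sum_comp_eq_id [Finite ι] (V W : ι → Type*) [∀ i, AddCommGroup (V i)]
    [∀ i, Module K (V i)] [∀ i, AddCommGroup (W i)] [∀ i, Module K (W i)]
    [∀ i, Module.Finite K (V i)] [∀ i, Nontrivial (W i)] :
    ∃ (n : ℕ) (q : Fin n → ((∀ i, W i) →ₗ[ι → K] (∀ i, V i)))
      (p : Fin n → ((∀ i, V i) →ₗ[ι → K] (∀ i, W i))), ∑ k, q k ∘ₗ p k = LinearMap.id := by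
  classical
  cases nonempty_fintype ι
  choose w hw using fun i => exists_ne (0 : W i)
  have h1 : ∀ i, ∃ f : Module.Dual K (W i), f (w i) = 1 := fun i => by
    obtain ⟨φ, hφ⟩ : ∃ φ : Module.Dual K (W i), φ (w i) ≠ 0 := by
      by_contra! hf
      exact hw i ((Module.forall_dual_apply_eq_zero_iff K (w i)).mp hf)
    exact ⟨(φ (w i))⁻¹ • φ, by simp [hφ]⟩
  choose l hl using h1
  let b := fun i => Module.finBasis K (V i)
  let J := Σ i, Fin (Module.finrank K (V i))
  let e : J ≃ Fin (Fintype.card J) := Fintype.equivFin J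
  let q : J → ((∀ i, W i) →ₗ[ι → K] (∀ i, V i)) := fun j =>
    singleHom j.1 ((l j.1).smulRight (b j.1 j.2))
  let p : J → ((∀ i, V i) →ₗ[ι → K] (∀ i, W i)) := fun j =>
    singleHom j.1 (((b j.1).coord j.2).smulRight (w j.1))
  refine ⟨Fintype.card J, fun k => q (e.symm k), fun k => p (e.symm k), ?_⟩
  rw [Equiv.sum_comp e.symm (fun j => q j ∘ₗ p j)]
  refine LinearMap.ext fun v => ?_
  rw [LinearMap.sum_apply, Fintype.sum_sigma]
  have h2 : ∀ i, ∑ k, (q ⟨i, k⟩ ∘ₗ p ⟨i, k⟩) v = Pi.single i (v i) := by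
    intro i
    have h3 : ∀ k, (q ⟨i, k⟩ ∘ₗ p ⟨i, k⟩) v = Pi.single i ((b i).repr (v i) k • b i k) := by
      intro k
      simp [q, p, singleHom, hl]
    simp only [h3]
    exact ((map_sum (AddMonoidHom.single V i) (fun k => (b i).repr (v i) k • b i k)
      Finset.univ).symm).trans (congrArg (Pi.single i) ((b i).sum_repr (v i)))
  simp only [h2]
  exact Finset.univ_sum_single v

/-- Linearity over `K^ι` means commuting with the projections to the factors, so such endomorphisms
are exactly the families of operators on the `V i`. -/
lemma exists_ringEquiv_end {A : Type*} [Ring A] [Algebra K A] {V : ι → Type*}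
    [∀ i, AddCommGroup (V i)] [∀ i, Module K (V i)] [∀ i, Module A (V i)]
    [∀ i, IsScalarTower K A (V i)] (h : IsComplete K A V) :
    ∃ e : A ≃+* Module.End (ι → K) (∀ i, V i), ∀ a v, e a v = a • v := by
  classical
  let F : A →+* Module.End (ι → K) (∀ i, V i) :=
    { toFun := fun a =>
        { toFun := fun v => a • v
          map_add' := smul_add a
          map_smul' := fun z v => funext fun i => (smul_comm (z i) a (v i)).symm }
      map_one' := LinearMap.ext fun v => one_smul A v
      map_mul' := fun a b => LinearMap.ext fun v => mul_smul a b v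
      map_zero' := LinearMap.ext fun v => zero_smul A v
      map_add' := fun a b => LinearMap.ext fun v => add_smul a b v }
  refine ⟨RingEquiv.ofBijective F ⟨(injective_iff_map_eq_zero F).mpr fun a ha =>
    h.injective a fun i x => ?_, fun f => ?_⟩, fun a v => rfl⟩
  · have h1 := congrFun (LinearMap.congr_fun ha (Pi.single i x)) i
    change a • (Pi.single i x : ∀ i, V i) i = 0 at h1
    rwa [Pi.single_eq_same] at h1
  · have hsingle : ∀ i (c : K) (x : V i), (Pi.single i (c • x) : ∀ i, V i) =
        (fun _ : ι => c) • (Pi.single i x : ∀ i, V i) := fun i c x => funext fun j => by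
      rw [Pi.smul_apply']
      rcases eq_or_ne j i with rfl | hj
      · rw [Pi.single_eq_same, Pi.single_eq_same]
      · rw [Pi.single_eq_of_ne hj, Pi.single_eq_of_ne hj, smul_zero]
    obtain ⟨a, ha⟩ := h.surjective fun i =>
      { toFun := fun x => f (Pi.single i x) i
        map_add' := fun x y => by rw [Pi.single_add, map_add, Pi.add_apply]
        map_smul' := fun c x => by rw [hsingle, map_smul, Pi.smul_apply', RingHom.id_apply] }
    refine ⟨a, LinearMap.ext fun v => funext fun i => (ha i (v i)).trans ?_⟩
    have h1 : (Pi.single i (1 : K) : ι → K) • v = Pi.single i (v i) := funext fun j => by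
      rw [Pi.smul_apply']
      rcases eq_or_ne j i with rfl | hj
      · rw [Pi.single_eq_same, Pi.single_eq_same, one_smul]
      · rw [Pi.single_eq_of_ne hj, Pi.single_eq_of_ne hj, zero_smul]
    change f (Pi.single i (v i)) i = f v i
    rw [← h1, map_smul, Pi.smul_apply', Pi.single_eq_same, one_smul]

end context

end GAlgebra

end

noncomputable section

namespace GAlgebra

/-! ### `G`-Morita equivalence from isomorphic decorated sets. -/

section

variable {K : Type u} [Field K] {G : Type v} [Group G] {A B : GAlgebra.{u, v} K G}

lemma IsProjectiveAction.symm_smul {ι : Type*} [MulAction G ι] {V : ι → A.AbsSimple}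
    {α : G → G → ι → Kˣ} {S : G → ((∀ i, (V i).mod) ≃+ (∀ i, (V i).mod))}
    (h : IsProjectiveAction V α S) (g : G) (a : A.carrier) (v : ∀ i, (V i).mod) :
    (S g).symm ((g • a) • v) = a • (S g).symm v := by
  rw [AddEquiv.symm_apply_eq, h.smul, AddEquiv.apply_symm_apply]

lemma IsProjectiveAction.symm_smul_fun {ι : Type*} [MulAction G ι] {V : ι → A.AbsSimple}
    {α : G → G → ι → Kˣ} {S : G → ((∀ i, (V i).mod) ≃+ (∀ i, (V i).mod))}
    (h : IsProjectiveAction V α S) (g : G) (z : ι → K) (v : ∀ i, (V i).mod) :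
    (S g).symm (z • v) = (fun i => z (g • i)) • (S g).symm v := by
  rw [AddEquiv.symm_apply_eq, h.smul_fun, AddEquiv.apply_symm_apply]
  simp only [smul_inv_smul]

variable {ι : Type} [MulAction G ι] {V : ι → A.AbsSimple} {W : ι → B.AbsSimple}
  {α : G → G → ι → Kˣ} {S : G → ((∀ i, (V i).mod) ≃+ (∀ i, (V i).mod))}
  {R : G → ((∀ i, (W i).mod) ≃+ (∀ i, (W i).mod))}

/-- The action `q ↦ S g ∘ q ∘ (R g)⁻¹` on homomorphisms. -/
def conjAction (hS : IsProjectiveAction V α S) (hR : IsProjectiveAction W α R) (g : G) :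
    ((∀ i, (W i).mod) →ₗ[ι → K] (∀ i, (V i).mod)) →+
      ((∀ i, (W i).mod) →ₗ[ι → K] (∀ i, (V i).mod)) where
  toFun q :=
    { toFun := fun w => S g (q ((R g).symm w))
      map_add' := fun w w' => by rw [map_add, map_add, map_add]
      map_smul' := fun z w => by
        rw [hR.symm_smul_fun, map_smul, hS.smul_fun]
        simp only [smul_inv_smul]
        rfl }
  map_zero' := LinearMap.ext fun w => map_zero (S g)
  map_add' q q' := LinearMap.ext fun w => map_add (S g) _ _

lemma conjAction_apply (hS : IsProjectiveAction V α S) (hR : IsProjectiveAction W α R) (g : G)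
    (q : (∀ i, (W i).mod) →ₗ[ι → K] (∀ i, (V i).mod)) (w : ∀ i, (W i).mod) :
    conjAction hS hR g q (R g w) = S g (q w) := by
  change S g (q ((R g).symm (R g w))) = _
  rw [AddEquiv.symm_apply_apply]

/-- Both projective actions have the same cocycle `α`, so the scalars cancel and `G` acts genuinely.
-/
lemma conjAction_mul (hS : IsProjectiveAction V α S) (hR : IsProjectiveAction W α R) (g h : G)
    (q : (∀ i, (W i).mod) →ₗ[ι → K] (∀ i, (V i).mod)) :
    conjAction hS hR (g * h) q = conjAction hS hR g (conjAction hS hR h q) := by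
  refine LinearMap.ext fun w => ?_
  obtain ⟨w, rfl⟩ := (R g).surjective w
  obtain ⟨w, rfl⟩ := (R h).surjective w
  rw [conjAction_apply, conjAction_apply, hR.mul, map_smul, conjAction_apply, hS.mul]

/-- The operator of `1` is idempotent by multiplicativity; bijectivity of `S 1` then forces it to be
the identity, without normalising `α`. -/
lemma conjAction_one (hS : IsProjectiveAction V α S) (hR : IsProjectiveAction W α R)
    (q : (∀ i, (W i).mod) →ₗ[ι → K] (∀ i, (V i).mod)) : conjAction hS hR 1 q = q := by
  have h1 := conjAction_mul hS hR 1 1 q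
  rw [one_mul] at h1
  refine LinearMap.ext fun w => (S 1).injective ?_
  rw [← conjAction_apply hS hR, ← conjAction_apply hS hR, ← h1]

lemma nonempty_gMoritaContext [Finite ι] (hV : IsComplete K A.carrier (fun i => (V i).mod))
    (hW : IsComplete K B.carrier (fun i => (W i).mod))
    (hS : IsProjectiveAction V α S) (hR : IsProjectiveAction W α R) :
    Nonempty (GMoritaContext A B) := by
  obtain ⟨eA, hA⟩ := exists_ringEquiv_end hV
  obtain ⟨eB, hB⟩ := exists_ringEquiv_end hW
  have h1 := hV.finite
  have h2 := hV.nontrivial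
  have h3 := hW.finite
  have h4 := hW.nontrivial
  obtain ⟨n, q, p, hqp⟩ := exists_sum_comp_eq_id (K := K) (fun i => (V i).mod) (fun i => (W i).mod)
  obtain ⟨n', p', q', hpq⟩ :=
    exists_sum_comp_eq_id (K := K) (fun i => (W i).mod) (fun i => (V i).mod)
  refine ⟨{ endContext eA eB q p hqp q' p' hpq with
    γ := conjAction hS hR
    γ_one := conjAction_one hS hR
    γ_mul := conjAction_mul hS hR
    γ_smul := fun g a x => LinearMap.ext fun w => ?_
    γ_right := fun g b x => LinearMap.ext fun w => ?_
    right_algebraMap := fun c x => LinearMap.ext fun w => ?_ }⟩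
  · change S g (eA a (x ((R g).symm w))) = eA (g • a) (S g (x ((R g).symm w)))
    rw [hA, hA, hS.smul]
  · change S g (x (eB b ((R g).symm w))) = S g (x ((R g).symm (eB (g • b) w)))
    rw [hB, hB, hR.symm_smul]
  · change x (eB (algebraMap K B.carrier c) w) = eA (algebraMap K A.carrier c) (x w)
    rw [hA, hB]
    exact x.map_smul (fun _ => c) w

lemma mk_eq_muConj_frill (x : A.IrrSet) {H : Subgroup G} (hH : H ≤ stab G x) {θ : Z2 H K}
    (h : IsObstruction (irrRep x).mod H θ) :
    (QuotientGroup.mk θ : Mu H K) = muConj K 1 H (stab G x) (conj_one hH) (A.Irr.frill x) := by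
  obtain ⟨θ', h', hθ'⟩ := exists_isObstruction_out x
  refine Eq.trans ?_ (congrArg (muConj K 1 _ _ (conj_one hH)) hθ').symm
  exact isObstruction_unique (irrRep x).2 h (h'.restrict (conj_one hH))

lemma GMoritaEquivalent.of_isomorphic_irr (hA : A.IsSemisimpleSplit) (hB : B.IsSemisimpleSplit)
    (h : DecSet.Isomorphic A.Irr B.Irr) : GMoritaEquivalent A B := by
  obtain ⟨f, hf, hfr⟩ := h
  have := hA.finite_irr
  -- Both families of simple modules are indexed by one small `G`-set, `B` through `f`; this keeps
  -- the products in the universe of the algebras.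
  obtain ⟨n, ⟨e⟩⟩ := Finite.exists_equiv_fin A.IrrSet
  let _ : MulAction G (Fin n) := e.symm.mulAction G
  have he : ∀ (g : G) i, e.symm (g • i) = g • e.symm i := fun g i => by
    rw [e.symm_apply_eq, Equiv.smul_def, Equiv.symm_symm]
  let V : Fin n → A.AbsSimple := fun i => irrRep (e.symm i)
  let W : Fin n → B.AbsSimple := fun i => irrRep (f (e.symm i))
  have hVc : ∀ i, (V i).cls = e.symm i := fun i => cls_irrRep _
  have hWc : ∀ i, (W i).cls = f (e.symm i) := fun i => cls_irrRep _
  have hV : IsComplete K A.carrier (fun i => (V i).mod) := hA.isComplete_of_bijective V (by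
    simpa only [hVc] using e.symm.bijective)
  have hW : IsComplete K B.carrier (fun i => (W i).mod) := hB.isComplete_of_bijective W (by
    simp only [hWc]
    exact f.bijective.comp e.symm.bijective)
  obtain ⟨α, hα, S, hS, hθ⟩ := exists_projectiveAction V fun g i => by rw [hVc, hVc, he]
  obtain ⟨β, hβ, R, hR, hη⟩ := exists_projectiveAction W fun g i => by
    rw [hWc, hWc, he]
    exact hf g _
  have hαβ : ∀ i, (QuotientGroup.mk (hα.restrict i) : Mu (MulAction.stabilizer G i) K) =
      QuotientGroup.mk (hβ.restrict i) := by
    -- Both cocycles represent the pull-back of a frill to the stabiliser of `i`, and `f` preserves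
    -- frills.
    intro i
    have h1 : stab G i ≤ stab G (e.symm i) := fun a ha => by
      rw [MulAction.mem_stabilizer_iff] at ha ⊢
      rw [← he, ha]
    have h2 : stab G i ≤ stab G (f (e.symm i)) :=
      h1.trans (stab_map_le (X := A.Irr.carrier) hf (e.symm i))
    refine (mk_eq_muConj_frill (e.symm i) h1 (hθ i)).trans
      (Eq.trans ?_ (mk_eq_muConj_frill (f (e.symm i)) h2 (hη i)).symm)
    refine (congrArg (muConj K 1 _ _ (conj_one h1)) (hfr (e.symm i))).trans ?_
    exact muConj_comp K 1 1 1 _ _ _ _ _ _ (by simp) _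
  obtain ⟨R', hR'⟩ := hR.rescale hα hβ hαβ
  obtain ⟨C⟩ := nonempty_gMoritaContext hV hW hS hR'
  exact ⟨C.gEquivalence⟩

lemma gMoritaEquivalent_iff (hA : A.IsSemisimpleSplit) (hB : B.IsSemisimpleSplit) :
    GMoritaEquivalent A B ↔ DecSet.Isomorphic A.Irr B.Irr :=
  ⟨fun ⟨E⟩ => E.isomorphic_irr hA hB, .of_isomorphic_irr hA hB⟩

end

end GAlgebra

end

end GMorita

theorem mainTheorem2 (K : Type u) [Field K] (G : Type v) [Group G] [Finite G] :
    ∃ (hM : Equivalence (GMorita.SplitGAlgebra.Rel K G))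
      (hfin : ∀ A : GMorita.SplitGAlgebra K G, Finite A.1.Irr.carrier)
      (Υ : Quotient (⟨GMorita.SplitGAlgebra.Rel K G, hM⟩ : Setoid (GMorita.SplitGAlgebra K G)) →
        GMorita.DecClass.{u, v, u + 1} K G),
      (∀ A : GMorita.SplitGAlgebra K G,
        Υ (Quotient.mk _ A) = GMorita.DecClass.mk A.1.Irr (hfin A)) ∧
      Function.Bijective Υ ∧
      (∀ A B : GMorita.SplitGAlgebra K G, ∃ h : (A.1.tensor B.1).IsSemisimpleSplit,
        Υ (Quotient.mk _ ⟨A.1.tensor B.1, h⟩) = Υ (Quotient.mk _ A) * Υ (Quotient.mk _ B)) ∧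
      (∀ A B : GMorita.SplitGAlgebra K G, ∃ h : (A.1.directSum B.1).IsSemisimpleSplit,
        Υ (Quotient.mk _ ⟨A.1.directSum B.1, h⟩) = Υ (Quotient.mk _ A) + Υ (Quotient.mk _ B)) ∧
      (∀ A : GMorita.SplitGAlgebra K G, ∃ h : A.1.opposite.IsSemisimpleSplit,
        Υ (Quotient.mk _ ⟨A.1.opposite, h⟩) = (Υ (Quotient.mk _ A)).dual) := by
  -- On split semisimple `G`-algebras the relation coincides with isomorphism of `Irr`. Reflexivity,
  -- symmetry and transitivity are inherited from decorated sets, so `G`-equivalences are never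
  -- composed or inverted.
  have hrel : ∀ A B : GMorita.SplitGAlgebra K G,
      GMorita.SplitGAlgebra.Rel K G A B ↔ GMorita.DecSet.Isomorphic A.1.Irr B.1.Irr :=
    fun A B => GMorita.GAlgebra.gMoritaEquivalent_iff A.2 B.2
  have hiso := GMorita.DecSet.isomorphic_equivalence (K := K) (G := G)
  have hfin : ∀ A : GMorita.SplitGAlgebra K G, Finite A.1.Irr.carrier := fun A => A.2.finite_irr
  refine ⟨⟨fun A => (hrel A A).mpr (hiso.refl _),
    fun {A B} h => (hrel B A).mpr (hiso.symm ((hrel A B).mp h)),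
    fun {A B C} h h' => (hrel A C).mpr (hiso.trans ((hrel A B).mp h) ((hrel B C).mp h'))⟩, hfin,
    Quotient.lift (fun A => GMorita.DecClass.mk A.1.Irr (hfin A))
      (fun A B h => Quotient.sound ((hrel A B).mp h)), fun A => rfl, ⟨?_, ?_⟩, ?_, ?_, ?_⟩
  · rintro ⟨A⟩ ⟨B⟩ h
    exact Quotient.sound ((hrel A B).mpr (Quotient.exact h))
  · rintro ⟨⟨X, hX⟩⟩
    obtain ⟨A, hA, h⟩ := X.exists_isomorphic_irr
    exact ⟨Quotient.mk _ ⟨A, hA⟩, Quotient.sound (hiso.symm h)⟩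
  · intro A B
    exact ⟨A.2.tensor B.2, Quotient.sound
      (hiso.symm (GMorita.GAlgebra.tensor_isomorphic_irr A.2 B.2))⟩
  · intro A B
    exact ⟨A.2.directSum B.2, Quotient.sound
      (hiso.symm (GMorita.GAlgebra.sum_isomorphic_irr A.2 B.2))⟩
  · intro A
    exact ⟨A.2.opposite, Quotient.sound (hiso.symm (GMorita.GAlgebra.dual_isomorphic_irr A.2))⟩
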